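/- Let $\mathbb H=\{z=x+iy: y>0\}$. For smooth $f:\mathbb H\to\mathbb C$ and $k\in\{0,2\}$ let $$\Delta_k f= y^2\Big(\frac{\partial^2 f}{\partial x^2}+\frac{\partial^2 f}{\partial y^2}\Big)-iky\Big(\frac{\partial f}{\partial x}+i\frac{\partial f}{\partial y}\Big),\qquad \xi_k f=2i\,y^k\,\overline{\frac{\partial f}{\partial\bar z}},\qquad \frac{\partial}{\partial \bar z}=\frac12\Big(\frac{\partial}{\partial x}+i\frac{\partial}{\partial y}\Big).$$ For $\Re(s)>1-\frac k2$ let $$E_k(z,s)=\frac12\sum_{(m,n)\in\mathbb Z^2\setminus\{(0,0)\}}\frac{y^s}{(mz+n)^k|mz+n|^{2s}} .$$ Then for each $z\in\mathbb H$ the functions $$s(s-1)\,\pi^{-s}\,\Gamma(s)\,E_0(z,s)\qquad\text{and}\qquad (s+1)s\,\pi^{-(s+1)}\,\Gamma(s+2)\,E_2(z,s)$$ continue to entire functions $\widehat{\widehat E}_0(z,s)$ and $\widehat{\widehat E}_2(z,s)$ of $s\in\mathbb C$. Define $F_n$ and $G_n$ by the Taylor expansions $$\widehat{\widehat E}_0(z,s)=\sum_{n\ge0}F_n(z)s^n,\qquad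 \widehat{\widehat E}_2(z,s)=\sum_{n\ge0}G_n(z)s^n,$$ and put, for $n\ge 0$, $$\widetilde F_n=(-1)^n\Big(F_n+\sum_{\ell=1}^n\binom{n+\ell}{n}F_{n-\ell}\Big),\qquad \widetilde G_n=G_n+\sum_{\ell=1}^n(-1)^\ell\binom{n+\ell}{n}G_{n-\ell},$$ and $\widetilde F_{-1}=\widetilde G_{-1}=0$. Then for every $n\ge0$ the functions $\widetilde F_n$ and $\widetilde G_n$ are smooth on $\mathbb H$, and 1. $\Delta_0\widetilde F_n=\widetilde F_{n-1}$ and $\xi_0\widetilde F_n=\widetilde G_n$; 2. $\Delta_2\widetilde G_n=\widetilde G_{n-1}$ and $\xi_2\widetilde G_n=\widetilde F_{n-1}$. -/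

import Mathlib

open scoped UpperHalfPlane ContDiff Nat

noncomputable section

namespace PolyharmonicMaass

/-- The partial derivative `∂f/∂x` of a function on the upper half-plane, `z = x + iy`. -/
def partialX (f : ℍ → ℂ) (z : ℍ) : ℂ :=
  lineDeriv ℝ (fun w : ℂ => f (UpperHalfPlane.ofComplex w)) (z : ℂ) 1

/-- The partial derivative `∂f/∂y` of a function on the upper half-plane, `z = x + iy`. -/
def partialY (f : ℍ → ℂ) (z : ℍ) : ℂ :=
  lineDeriv ℝ (fun w : ℂ => f (UpperHalfPlane.ofComplex w)) (z : ℂ) Complex.I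

/-- The Wirtinger derivative `∂f/∂z̄ = (1/2) (∂f/∂x + i ∂f/∂y)`. -/
def dbar (f : ℍ → ℂ) (z : ℍ) : ℂ :=
  (1 / 2) * (partialX f z + Complex.I * partialY f z)

/-- The weight `k` hyperbolic Laplacian
`Δ_k = y² (∂²/∂x² + ∂²/∂y²) - i k y (∂/∂x + i ∂/∂y)`. -/
def laplacian (k : ℤ) (f : ℍ → ℂ) (z : ℍ) : ℂ :=
  (z.im : ℂ) ^ 2 * (partialX (partialX f) z + partialY (partialY f) z)
    - Complex.I * k * z.im * (partialX f z + Complex.I * partialY f z)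

/-- The operator `ξ_k f = 2 i y^k · conj (∂f/∂z̄)`. -/
def xi (k : ℤ) (f : ℍ → ℂ) (z : ℍ) : ℂ :=
  2 * Complex.I * (z.im : ℂ) ^ k * (starRingEnd ℂ) (dbar f z)

/-- `f` is infinitely differentiable as a function of the two real variables `x, y`. -/
def IsSmooth (f : ℍ → ℂ) : Prop :=
  ContDiffOn ℝ ∞ (fun w : ℂ => f (UpperHalfPlane.ofComplex w)) {w : ℂ | 0 < w.im}

/-- The weight `k` non-holomorphic Eisenstein series
`E_k(z, s) = (1/2) ∑_{(m,n) ≠ (0,0)} y^s / ((mz+n)^k |mz+n|^{2s})`,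
absolutely convergent for `Re s > 1 - k/2`. -/
def eisensteinSeries (k : ℤ) (z : ℍ) (s : ℂ) : ℂ :=
  (1 / 2) * ∑' p : {p : ℤ × ℤ // p ≠ (0, 0)},
    (z.im : ℂ) ^ s /
      (((p.1.1 : ℂ) * z + p.1.2) ^ k * ((‖(p.1.1 : ℂ) * z + p.1.2‖ : ℝ) : ℂ) ^ (2 * s))

/-- `f` is an entire function of `s` that agrees, for `Re s > 1 - k/2`, with
`(s + k/2) (s + k/2 - 1) π^{-(s + k/2)} Γ(s + k/2 + |k|/2) E_k(z, s)`. -/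
def IsDoublyCompleted (k : ℤ) (z : ℍ) (f : ℂ → ℂ) : Prop :=
  Differentiable ℂ f ∧
    ∀ s : ℂ, 1 - (k : ℝ) / 2 < s.re →
      f s = (s + (k : ℂ) / 2) * (s + (k : ℂ) / 2 - 1) *
        ((Real.pi : ℂ) ^ (-(s + (k : ℂ) / 2)) *
          Complex.Gamma (s + (k : ℂ) / 2 + ((|k| : ℤ) : ℂ) / 2) * eisensteinSeries k z s)

/-- The doubly completed Eisenstein series of weight `k`, as a function of `s ∈ ℂ`: the entire
function with the property `IsDoublyCompleted` (at most one function has it, by the identity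
theorem; that one exists for the weights in use is part of what the main theorem asserts). -/
def doublyCompleted (k : ℤ) (z : ℍ) : ℂ → ℂ :=
  Classical.epsilon (IsDoublyCompleted k z)

/-- The coefficient of `s ^ n` in the Taylor expansion at `s = 0` of the doubly completed
Eisenstein series of weight `k`. -/
def taylorCoeff (k : ℤ) (n : ℕ) (z : ℍ) : ℂ :=
  iteratedDeriv n (doublyCompleted k z) 0 / (n ! : ℂ)

/-- The Taylor basis function `F_n` of weight `0`. -/
def F (n : ℕ) : ℍ → ℂ := taylorCoeff 0 n

/-- The Taylor basis function `G_n` of weight `2`. -/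
def G (n : ℕ) : ℍ → ℂ := taylorCoeff 2 n

/-- The symmetrized Taylor basis function `F̃_n` of weight `0`. -/
def symF (n : ℕ) (z : ℍ) : ℂ :=
  (-1) ^ n * (F n z + ∑ l ∈ Finset.Icc 1 n, ((n + l).choose n : ℂ) * F (n - l) z)

/-- The symmetrized Taylor basis function `G̃_n` of weight `2`. -/
def symG (n : ℕ) (z : ℍ) : ℂ :=
  G n z + ∑ l ∈ Finset.Icc 1 n, (-1) ^ l * ((n + l).choose n : ℂ) * G (n - l) z

end PolyharmonicMaass

end

/-! Everything is transported through the theta series `θ(z,t) = ∑ exp(-π t Q_z(m,n))` over nonzero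
`(m,n)`, where `Q_z(m,n) = |mz+n|²/y`. Poisson summation gives `1 + θ(z,1/t) = t (1 + θ(z,t))`.
Hence, for `Re s > 1`, the Mellin transform of `θ`, which is `2 π^{-s} Γ(s) E_0(z,s)`, equals `S(s)
+ 1/(s(s-1))`, where `S(s) = ∫_{t>1} θ (t^s + t^{1-s}) dt/t` is entire
(`DecaysExponentially.hasMellin`). The doubly completed series of weight 0 is therefore `1/2 +
s(s-1) S(s)/2`.

The operators act on the exponentials. `ξ₀` multiplies each one by `π t (m z̄ + n)²/y²`, and the
Mellin transform of the result is a completed `E_2`. `Δ₀` multiplies by `L² + 2L` with `L = -π t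
Q_z`, and `Γ(s+2) - 2Γ(s+1) = s(s-1)Γ(s)` turns this into the eigenvalue `s(s-1)`. Comparing Taylor
coefficients at 0 gives `ξ₀ F_n = (-1)^n G_n` (`xi_F`) and `Δ₀ F_n = F_{n-2} - F_{n-1}`, with terms
of negative index zero (`laplacian_F_add_two`).

Since `∑_l C(n+l,n) s^l = (1-s)^{-n-1}`, the function `F̃_n` is minus the residue at 0 of the
completed series divided by `(s(s-1))^{n+1}`, so multiplication by `s(s-1)` lowers `n` by one. The
formal counterpart used here is a Pascal rule argument, `sum_choose_mul_of_recurrence`. The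
remaining weight 2 identities follow from `G̃_n = ξ₀ F̃_n`, `ξ₂ ξ₀ = Δ₀` and `ξ₀ ξ₂ = Δ₂`.

The analytic burden is smoothness and differentiation under the sum and integral. The exponent is
linear in the three coefficients of `Q_z`, so a theta integral is a Laplace transform on `ℝ³`
composed with `gram`. Each derivative only brings down a linear form
(`hasFDerivAt_laplaceIntegral`). -/

namespace PolyharmonicMaass

/-! ### Calculus of directional derivatives on the upper half-plane -/

/-- The open upper half-plane as a subset of `ℂ`. -/
def halfPlane : Set ℂ := {w : ℂ | 0 < w.im}

lemma isOpen_halfPlane : IsOpen halfPlane :=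
  isOpen_lt continuous_const Complex.continuous_im

lemma halfPlane_mem_nhds (z : ℍ) : halfPlane ∈ nhds (z : ℂ) :=
  isOpen_halfPlane.mem_nhds z.im_pos

/-- The extension of a function on `ℍ` to `ℂ` through `UpperHalfPlane.ofComplex`. -/
noncomputable def extend (f : ℍ → ℂ) (w : ℂ) : ℂ := f (UpperHalfPlane.ofComplex w)

lemma extend_coe (f : ℍ → ℂ) (z : ℍ) : extend f z = f z := by
  simp [extend]

/-- The derivative of a function on `ℍ` in the direction `v`. -/
noncomputable def dirDeriv (v : ℂ) (f : ℍ → ℂ) (z : ℍ) : ℂ := lineDeriv ℝ (extend f) (z : ℂ) v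

lemma IsSmooth.contDiffAt {f : ℍ → ℂ} (hf : IsSmooth f) (z : ℍ) :
    ContDiffAt ℝ ∞ (extend f) (z : ℂ) :=
  ContDiffOn.contDiffAt hf (halfPlane_mem_nhds z)

lemma isSmooth_of_contDiffAt {f : ℍ → ℂ} (hf : ∀ z : ℍ, ContDiffAt ℝ ∞ (extend f) (z : ℂ)) :
    IsSmooth f := fun w hw => (hf ⟨w, hw⟩).contDiffWithinAt

lemma IsSmooth.differentiableAt {f : ℍ → ℂ} (hf : IsSmooth f) (z : ℍ) :
    DifferentiableAt ℝ (extend f) (z : ℂ) :=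
  (hf.contDiffAt z).differentiableAt (by simp)

lemma IsSmooth.dirDeriv_eq {f : ℍ → ℂ} (hf : IsSmooth f) (v : ℂ) (z : ℍ) :
    dirDeriv v f z = fderiv ℝ (extend f) z v :=
  (hf.differentiableAt z).lineDeriv_eq_fderiv

/-- Agreement on a neighbourhood, not only at `z`, is what allows a second differentiation to be
computed with `fderiv`. -/
lemma IsSmooth.extend_dirDeriv {f : ℍ → ℂ} (hf : IsSmooth f) (v : ℂ) (z : ℍ) :
    extend (dirDeriv v f) =ᶠ[nhds (z : ℂ)] fun w => fderiv ℝ (extend f) w v := by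
  filter_upwards [halfPlane_mem_nhds z] with w hw
  exact (extend_coe (PolyharmonicMaass.dirDeriv v f) ⟨w, hw⟩).trans (hf.dirDeriv_eq v ⟨w, hw⟩)

lemma IsSmooth.dirDeriv {f : ℍ → ℂ} (hf : IsSmooth f) (v : ℂ) : IsSmooth (dirDeriv v f) := by
  refine isSmooth_of_contDiffAt fun z => ContDiffAt.congr_of_eventuallyEq ?_ (hf.extend_dirDeriv v z)
  exact ((hf.contDiffAt z).fderiv_right (m := ∞) (by simp)).clm_apply contDiffAt_const

/-- Symmetry of the second derivative; it cancels the mixed terms in `(∂_x - i∂_y)(∂_x + i∂_y)`. -/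
lemma IsSmooth.dirDeriv_comm {f : ℍ → ℂ} (hf : IsSmooth f) (u v : ℂ) (z : ℍ) :
    PolyharmonicMaass.dirDeriv u (PolyharmonicMaass.dirDeriv v f) z =
      PolyharmonicMaass.dirDeriv v (PolyharmonicMaass.dirDeriv u f) z := by
  have key : ∀ u v : ℂ, PolyharmonicMaass.dirDeriv u (PolyharmonicMaass.dirDeriv v f) z =
      fderiv ℝ (fderiv ℝ (extend f)) z u v := by
    intro u v
    have hd : DifferentiableAt ℝ (fderiv ℝ (extend f)) (z : ℂ) :=
      ((hf.contDiffAt z).fderiv_right (m := ∞) (by simp)).differentiableAt (by simp)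
    rw [(hf.dirDeriv v).dirDeriv_eq, (hf.extend_dirDeriv v z).fderiv_eq,
      fderiv_clm_apply hd (differentiableAt_const _)]
    simp
  rw [key, key]
  exact ((hf.contDiffAt z).isSymmSndFDerivAt (by simpa using ENat.LEInfty.out)) u v

lemma IsSmooth.add {f g : ℍ → ℂ} (hf : IsSmooth f) (hg : IsSmooth g) :
    IsSmooth (fun z => f z + g z) := ContDiffOn.add hf hg

lemma IsSmooth.mul {f g : ℍ → ℂ} (hf : IsSmooth f) (hg : IsSmooth g) :
    IsSmooth (fun z => f z * g z) := ContDiffOn.mul hf hg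

lemma isSmooth_const (c : ℂ) : IsSmooth (fun _ => c) := contDiffOn_const

lemma IsSmooth.const_mul {f : ℍ → ℂ} (hf : IsSmooth f) (c : ℂ) :
    IsSmooth (fun z => c * f z) := (isSmooth_const c).mul hf

lemma IsSmooth.conj {f : ℍ → ℂ} (hf : IsSmooth f) :
    IsSmooth (fun z => (starRingEnd ℂ) (f z)) :=
  (Complex.conjCLE.contDiff.contDiffOn (s := Set.univ)).comp hf (fun _ _ => Set.mem_univ _)

lemma IsSmooth.sum {ι : Type*} {s : Finset ι} {f : ι → ℍ → ℂ} (hf : ∀ i ∈ s, IsSmooth (f i)) :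
    IsSmooth (fun z => ∑ i ∈ s, f i z) := ContDiffOn.sum hf

lemma extend_im_eq (z : ℍ) :
    extend (fun z => (z.im : ℂ)) =ᶠ[nhds (z : ℂ)] fun w => ((Complex.imCLM w : ℝ) : ℂ) := by
  filter_upwards [halfPlane_mem_nhds z] with w hw
  have := extend_coe (fun z => (z.im : ℂ)) ⟨w, hw⟩
  exact this

lemma isSmooth_im : IsSmooth (fun z => (z.im : ℂ)) :=
  isSmooth_of_contDiffAt fun z => ContDiffAt.congr_of_eventuallyEq
    ((Complex.ofRealCLM.contDiff.comp Complex.imCLM.contDiff).contDiffAt) (extend_im_eq z)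

lemma dirDeriv_im (v : ℂ) (z : ℍ) : dirDeriv v (fun z => (z.im : ℂ)) z = (v.im : ℂ) := by
  rw [isSmooth_im.dirDeriv_eq, (extend_im_eq z).fderiv_eq]
  have := (Complex.ofRealCLM.comp Complex.imCLM).hasFDerivAt (x := (z : ℂ))
  exact (congrArg (fun L => L v) this.fderiv)

lemma dirDeriv_const (v c : ℂ) (z : ℍ) : dirDeriv v (fun _ => c) z = 0 := by
  rw [(isSmooth_const c).dirDeriv_eq]
  have : extend (fun _ => c) = fun _ => c := rfl
  simp [this]

lemma dirDeriv_add {f g : ℍ → ℂ} (hf : IsSmooth f) (hg : IsSmooth g) (v : ℂ) (z : ℍ) :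
    dirDeriv v (fun z => f z + g z) z = dirDeriv v f z + dirDeriv v g z := by
  rw [(hf.add hg).dirDeriv_eq, hf.dirDeriv_eq, hg.dirDeriv_eq]
  exact congrArg (fun L => L v) (fderiv_add (hf.differentiableAt z) (hg.differentiableAt z))

lemma dirDeriv_mul {f g : ℍ → ℂ} (hf : IsSmooth f) (hg : IsSmooth g) (v : ℂ) (z : ℍ) :
    dirDeriv v (fun z => f z * g z) z = f z * dirDeriv v g z + g z * dirDeriv v f z := by
  rw [(hf.mul hg).dirDeriv_eq, hf.dirDeriv_eq, hg.dirDeriv_eq]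
  have := congrArg (fun L => L v) (fderiv_mul (hf.differentiableAt z) (hg.differentiableAt z))
  simp only [extend_coe] at this
  exact this

lemma dirDeriv_const_mul {f : ℍ → ℂ} (hf : IsSmooth f) (c v : ℂ) (z : ℍ) :
    dirDeriv v (fun z => c * f z) z = c * dirDeriv v f z := by
  rw [dirDeriv_mul (isSmooth_const c) hf, dirDeriv_const]; ring

lemma dirDeriv_conj {f : ℍ → ℂ} (hf : IsSmooth f) (v : ℂ) (z : ℍ) :
    dirDeriv v (fun z => (starRingEnd ℂ) (f z)) z = (starRingEnd ℂ) (dirDeriv v f z) := by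
  rw [hf.conj.dirDeriv_eq, hf.dirDeriv_eq]
  have := (Complex.conjCLE.toContinuousLinearMap.hasFDerivAt.comp (z : ℂ)
    (hf.differentiableAt z).hasFDerivAt).fderiv
  exact congrArg (fun L => L v) this

lemma dirDeriv_sum {ι : Type*} {s : Finset ι} {f : ι → ℍ → ℂ} (hf : ∀ i ∈ s, IsSmooth (f i))
    (v : ℂ) (z : ℍ) :
    dirDeriv v (fun z => ∑ i ∈ s, f i z) z = ∑ i ∈ s, dirDeriv v (f i) z := by
  classical
  induction s using Finset.induction_on with
  | empty => simpa using dirDeriv_const v 0 z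
  | insert a s ha ih =>
    simp only [Finset.sum_insert ha]
    rw [dirDeriv_add (hf a (by simp)) (IsSmooth.sum fun i hi => hf i (by simp [hi])),
      ih fun i hi => hf i (by simp [hi])]

/-! ### The operators `ξ_k` and `Δ_k` -/

lemma dbar_eq (f : ℍ → ℂ) (z : ℍ) :
    dbar f z = 1 / 2 * (dirDeriv 1 f z + Complex.I * dirDeriv Complex.I f z) := rfl

lemma laplacian_eq (k : ℤ) (f : ℍ → ℂ) (z : ℍ) :
    laplacian k f z = (z.im : ℂ) ^ 2 * (dirDeriv 1 (dirDeriv 1 f) z +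
        dirDeriv Complex.I (dirDeriv Complex.I f) z)
      - Complex.I * k * z.im * (dirDeriv 1 f z + Complex.I * dirDeriv Complex.I f z) := rfl

lemma IsSmooth.dbar {f : ℍ → ℂ} (hf : IsSmooth f) : IsSmooth (dbar f) :=
  ((hf.dirDeriv 1).add ((hf.dirDeriv Complex.I).const_mul Complex.I)).const_mul (1 / 2)

lemma dirDeriv_dbar {f : ℍ → ℂ} (hf : IsSmooth f) (v : ℂ) (z : ℍ) :
    dirDeriv v (dbar f) z = 1 / 2 * (dirDeriv v (dirDeriv 1 f) z +
      Complex.I * dirDeriv v (dirDeriv Complex.I f) z) := by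
  have h1 := hf.dirDeriv 1
  have h2 := (hf.dirDeriv Complex.I)
  have h3 := h2.const_mul Complex.I
  exact (dirDeriv_const_mul (h1.add h3) _ v z).trans
    (by rw [dirDeriv_add h1 h3, dirDeriv_const_mul h2])

lemma isSmooth_xi_zero {f : ℍ → ℂ} (hf : IsSmooth f) : IsSmooth (xi 0 f) := by
  have : xi 0 f = fun z => 2 * Complex.I * (starRingEnd ℂ) (dbar f z) := by
    funext z; simp [xi]
  rw [this]
  exact hf.dbar.conj.const_mul _

/-- The two conjugations cancel, leaving `4 y² ∂∂̄ f`. -/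
lemma xi_two_xi_zero {f : ℍ → ℂ} (hf : IsSmooth f) (z : ℍ) :
    xi 2 (xi 0 f) z = laplacian 0 f z := by
  have : xi 0 f = fun z => 2 * Complex.I * (starRingEnd ℂ) (dbar f z) := by
    funext z; simp [xi]
  rw [this, xi, zpow_ofNat, dbar_eq, dirDeriv_const_mul hf.dbar.conj, dirDeriv_const_mul hf.dbar.conj,
    dirDeriv_conj hf.dbar, dirDeriv_conj hf.dbar, dirDeriv_dbar hf, dirDeriv_dbar hf,
    hf.dirDeriv_comm 1 Complex.I, laplacian_eq]
  simp only [map_mul, map_add, map_div₀, map_one, map_ofNat, Complex.conj_conj, Complex.conj_I,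
    map_neg, neg_neg]
  push_cast
  ring_nf
  simp only [Complex.I_sq, Complex.I_pow_four]
  ring

/-- Here the composite is `4 ∂(y² ∂̄f)`; since `∂y = -i/2`, the product rule adds `-4iy ∂̄f`, the
first-order term of weight 2. -/
lemma xi_zero_xi_two {f : ℍ → ℂ} (hf : IsSmooth f) (z : ℍ) :
    xi 0 (xi 2 f) z = laplacian 2 f z := by
  have : xi 2 f = fun z => 2 * Complex.I * ((z.im : ℂ) * ((z.im : ℂ) *
      (starRingEnd ℂ) (dbar f z))) := by
    funext z; rw [xi, zpow_ofNat]; ring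
  have h1 := isSmooth_im.mul hf.dbar.conj
  have h2 := isSmooth_im.mul h1
  rw [this, xi, zpow_zero, dbar_eq, dirDeriv_const_mul h2, dirDeriv_const_mul h2,
    dirDeriv_mul isSmooth_im h1,
    dirDeriv_mul isSmooth_im h1, dirDeriv_mul isSmooth_im hf.dbar.conj,
    dirDeriv_mul isSmooth_im hf.dbar.conj, dirDeriv_im, dirDeriv_im,
    dirDeriv_conj hf.dbar, dirDeriv_conj hf.dbar, dirDeriv_dbar hf, dirDeriv_dbar hf, dbar_eq,
    hf.dirDeriv_comm 1 Complex.I, laplacian_eq]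
  simp only [map_mul, map_add, map_div₀, map_one, map_ofNat, Complex.conj_conj, Complex.conj_I,
    map_neg, neg_neg,
    Complex.one_im, Complex.I_im, Complex.conj_ofReal]
  push_cast
  ring_nf
  simp only [Complex.I_sq, Complex.I_pow_three, Complex.I_pow_four]
  ring

/-- The coefficients are real because `ξ_k` is conjugate-linear. -/
lemma xi_sum {ι : Type*} {s : Finset ι} {f : ι → ℍ → ℂ} (hf : ∀ i ∈ s, IsSmooth (f i))
    (c : ι → ℝ) (k : ℤ) (z : ℍ) :
    xi k (fun z => ∑ i ∈ s, (c i : ℂ) * f i z) z = ∑ i ∈ s, (c i : ℂ) * xi k (f i) z := by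
  have h : ∀ v, dirDeriv v (fun z => ∑ i ∈ s, (c i : ℂ) * f i z) z =
      ∑ i ∈ s, (c i : ℂ) * dirDeriv v (f i) z := fun v => by
    rw [dirDeriv_sum fun i hi => (hf i hi).const_mul _]
    exact Finset.sum_congr rfl fun i hi => dirDeriv_const_mul (hf i hi) _ _ _
  simp only [xi, dbar_eq, h, Finset.mul_sum, ← Finset.sum_add_distrib, map_sum]
  refine Finset.sum_congr rfl fun i _ => ?_
  simp only [map_mul, map_add, Complex.conj_ofReal]
  ring

lemma laplacian_sum {ι : Type*} {s : Finset ι} {f : ι → ℍ → ℂ} (hf : ∀ i ∈ s, IsSmooth (f i))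
    (c : ι → ℂ) (k : ℤ) (z : ℍ) :
    laplacian k (fun z => ∑ i ∈ s, c i * f i z) z = ∑ i ∈ s, c i * laplacian k (f i) z := by
  have h : ∀ (v : ℂ) {f : ι → ℍ → ℂ} (_ : ∀ i ∈ s, IsSmooth (f i)),
      dirDeriv v (fun z => ∑ i ∈ s, c i * f i z) = fun z =>
      ∑ i ∈ s, c i * dirDeriv v (f i) z := fun v f hf => by
    funext z
    rw [dirDeriv_sum fun i hi => (hf i hi).const_mul _]
    exact Finset.sum_congr rfl fun i hi => dirDeriv_const_mul (hf i hi) _ _ _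
  simp only [laplacian_eq, h _ hf, h _ (fun i hi => (hf i hi).dirDeriv _), Finset.mul_sum,
    ← Finset.sum_add_distrib, ← Finset.sum_sub_distrib]
  refine Finset.sum_congr rfl fun i _ => ?_
  ring

lemma dirDeriv_affine {f : ℍ → ℂ} (hf : IsSmooth f) (c d v : ℂ) :
    dirDeriv v (fun z => c * f z + d) = fun z => c * dirDeriv v f z := by
  funext z
  rw [dirDeriv_add (hf.const_mul c) (isSmooth_const d), dirDeriv_const_mul hf, dirDeriv_const,
    add_zero]

/-- Additive constants disappear; this will remove the constant term from the theta transformation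
law. -/
lemma xi_affine {f : ℍ → ℂ} (hf : IsSmooth f) (c : ℝ) (d : ℂ) (k : ℤ) (z : ℍ) :
    xi k (fun z => (c : ℂ) * f z + d) z = c * xi k f z := by
  simp only [xi, dbar_eq, dirDeriv_affine hf, map_mul, map_add, Complex.conj_ofReal]
  ring

lemma laplacian_affine {f : ℍ → ℂ} (hf : IsSmooth f) (c d : ℂ) (k : ℤ) (z : ℍ) :
    laplacian k (fun z => c * f z + d) z = c * laplacian k f z := by
  simp only [laplacian_eq, dirDeriv_affine hf, dirDeriv_const_mul (hf.dirDeriv _)]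
  ring

/-! ### Laplace transforms along a family of linear forms -/

section Laplace

open MeasureTheory Filter Topology

variable {Ω : Type*} [MeasurableSpace Ω] {μ : Measure Ω}
  {V : Type} [NormedAddCommGroup V] [NormedSpace ℝ V]

/-- The vector-valued function `h` is `μ`-integrable against `exp (-δ N)` for each `δ > 0`. -/
structure IsTempered {F : Type} [NormedAddCommGroup F] (μ : Measure Ω) (N : Ω → ℝ) (h : Ω → F) :
    Prop where
  aestronglyMeasurable : AEStronglyMeasurable h μ
  integrable : ∀ δ : ℝ, 0 < δ → Integrable (fun a => Real.exp (-δ * N a) * ‖h a‖) μ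

/-- A family of linear forms `ℓ` is controlled by the weight `N` over the set `U`: it is bounded
by a multiple of `N`, and locally uniformly in `v ∈ U` one has `ℓ v ≤ -δ N`. -/
structure IsControlled (μ : Measure Ω) (N : Ω → ℝ) (ℓ : Ω → V →L[ℝ] ℝ) (U : Set V) : Prop where
  aestronglyMeasurable_weight : AEStronglyMeasurable N μ
  aestronglyMeasurable : AEStronglyMeasurable ℓ μ
  isOpen : IsOpen U
  nonneg : ∀ᵐ a ∂μ, 0 ≤ N a
  norm_le : ∃ C : ℝ, 0 ≤ C ∧ ∀ᵐ a ∂μ, ‖ℓ a‖ ≤ C * N a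
  le_neg : ∀ v₀ ∈ U, ∃ δ : ℝ, 0 < δ ∧ ∃ s ∈ 𝓝 v₀, ∀ᵐ a ∂μ, ∀ v ∈ s, ℓ a v ≤ -δ * N a

/-- The Laplace transform of the vector measure `h μ` along the linear forms `ℓ`. -/
noncomputable def laplaceIntegral {F : Type} [NormedAddCommGroup F] [NormedSpace ℝ F]
    (μ : Measure Ω) (ℓ : Ω → V →L[ℝ] ℝ) (h : Ω → F) (v : V) : F :=
  ∫ a, Real.exp (ℓ a v) • h a ∂μ

variable {N : Ω → ℝ} {ℓ : Ω → V →L[ℝ] ℝ} {U : Set V}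
  {F : Type} [NormedAddCommGroup F] [NormedSpace ℝ F] {h : Ω → F}

/-- Half of the exponential absorbs the linear factor, by `u ≤ exp u` at `u = δx/2`. -/
lemma mul_exp_neg_le {δ x : ℝ} (hδ : 0 < δ) :
    x * Real.exp (-δ * x) ≤ (2 / δ) * Real.exp (-(δ / 2) * x) := by
  have h1 : (δ / 2) * x ≤ Real.exp ((δ / 2) * x) :=
    (by linarith : (δ / 2) * x ≤ (δ / 2) * x + 1).trans (Real.add_one_le_exp _)
  have h2 : Real.exp (-δ * x) = Real.exp (-(δ / 2) * x) * Real.exp (-(δ / 2) * x) := by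
    rw [← Real.exp_add]; ring_nf
  have h3 : Real.exp ((δ / 2) * x) * Real.exp (-(δ / 2) * x) = 1 := by
    rw [← Real.exp_add]; simp
  have h4 := Real.exp_pos (-(δ / 2) * x)
  have h5 : x ≤ (2 / δ) * Real.exp ((δ / 2) * x) := by
    calc x = (2 / δ) * ((δ / 2) * x) := by field_simp
      _ ≤ _ := by gcongr
  calc x * Real.exp (-δ * x) ≤ (2 / δ) * Real.exp ((δ / 2) * x) * Real.exp (-δ * x) := by gcongr
    _ = (2 / δ) * Real.exp (-(δ / 2) * x) *
        (Real.exp ((δ / 2) * x) * Real.exp (-(δ / 2) * x)) := by rw [h2]; ring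
    _ = _ := by rw [h3, mul_one]

/-- Each factor `ℓ` costs at most `C N`, paid for by half the decay. Thus the admissible densities
are stable under differentiation. -/
lemma IsTempered.smulRight (hh : IsTempered μ N h) (hℓ : IsControlled μ N ℓ U) :
    IsTempered μ N (fun a => (ℓ a).smulRight (h a)) := by
  have hm : AEStronglyMeasurable (fun a => (ℓ a).smulRight (h a)) μ :=
    ((ContinuousLinearMap.smulRightL ℝ V F).continuous₂).comp_aestronglyMeasurable₂
      hℓ.aestronglyMeasurable hh.aestronglyMeasurable
  refine ⟨hm, fun δ hδ => ?_⟩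
  obtain ⟨C, hC, hℓC⟩ := hℓ.norm_le
  refine ((hh.integrable (δ / 2) (by positivity)).const_mul (C * (2 / δ))).mono' ?_ ?_
  · exact (Real.continuous_exp.comp_aestronglyMeasurable
      (hℓ.aestronglyMeasurable_weight.const_mul _)).mul hm.norm
  · filter_upwards [hℓC, hℓ.nonneg] with a h1 h2
    rw [norm_mul, norm_norm, Real.norm_of_nonneg (Real.exp_pos _).le,
      ContinuousLinearMap.norm_smulRight_apply]
    calc Real.exp (-δ * N a) * (‖ℓ a‖ * ‖h a‖)
        ≤ Real.exp (-δ * N a) * (C * N a * ‖h a‖) := by gcongr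
      _ = C * ‖h a‖ * (N a * Real.exp (-δ * N a)) := by ring
      _ ≤ C * ‖h a‖ * ((2 / δ) * Real.exp (-(δ / 2) * N a)) := by
          gcongr C * ‖h a‖ * ?_; exact mul_exp_neg_le hδ
      _ = _ := by ring

lemma IsControlled.aestronglyMeasurable_integrand (hℓ : IsControlled μ N ℓ U)
    (hh : IsTempered μ N h) (v : V) :
    AEStronglyMeasurable (fun a => Real.exp (ℓ a v) • h a) μ :=
  (Real.continuous_exp.comp_aestronglyMeasurable
    ((ContinuousLinearMap.apply ℝ ℝ v).continuous.comp_aestronglyMeasurable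
      hℓ.aestronglyMeasurable)).smul hh.aestronglyMeasurable

lemma IsControlled.integrable (hℓ : IsControlled μ N ℓ U) (hh : IsTempered μ N h) {v : V}
    (hv : v ∈ U) : Integrable (fun a => Real.exp (ℓ a v) • h a) μ := by
  obtain ⟨δ, hδ, s, hs, hle⟩ := hℓ.le_neg v hv
  refine (hh.integrable δ hδ).mono' (hℓ.aestronglyMeasurable_integrand hh v) ?_
  filter_upwards [hle] with a ha
  rw [norm_smul, Real.norm_of_nonneg (Real.exp_pos _).le]
  gcongr
  exact ha v (mem_of_mem_nhds hs)

/-- The derivative of `exp (ℓ a v)` brings down `ℓ a`, so the result is a Laplace integral of the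
same kind with a density valued in linear maps. The locally uniform bound `-δ N` supplies the
dominating function. -/
theorem hasFDerivAt_laplaceIntegral (hℓ : IsControlled μ N ℓ U) (hh : IsTempered μ N h) {v : V}
    (hv : v ∈ U) :
    HasFDerivAt (laplaceIntegral μ ℓ h)
      (laplaceIntegral μ ℓ (fun a => (ℓ a).smulRight (h a)) v) v := by
  obtain ⟨δ, hδ, s, hs, hle⟩ := hℓ.le_neg v hv
  have hh' := hh.smulRight hℓ
  refine hasFDerivAt_integral_of_dominated_of_fderiv_le (𝕜 := ℝ) (s := s)
    (F := fun v a => Real.exp (ℓ a v) • h a)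
    (F' := fun v a => Real.exp (ℓ a v) • (ℓ a).smulRight (h a)) hs
    (Eventually.of_forall fun v => hℓ.aestronglyMeasurable_integrand hh v) (hℓ.integrable hh hv)
    (hℓ.aestronglyMeasurable_integrand hh' v) ?_ (hh'.integrable δ hδ) ?_
  · filter_upwards [hle] with a ha w hw
    rw [norm_smul, Real.norm_of_nonneg (Real.exp_pos _).le]
    gcongr
    exact ha w hw
  · refine Eventually.of_forall fun a w _ => ?_
    have := ((ℓ a).hasFDerivAt (x := w)).exp.smul_const (h a)
    convert this using 1
    ext x
    simp [smul_smul]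

theorem contDiffOn_laplaceIntegral (hℓ : IsControlled μ N ℓ U) (hh : IsTempered μ N h) :
    ContDiffOn ℝ ∞ (laplaceIntegral μ ℓ h) U := by
  -- The target space must vary in the induction, since the derivative takes values in `V →L[ℝ] F`;
  -- both spaces lie in `Type` so that the universe does not change.
  have key : ∀ n : ℕ, ∀ (F : Type) [NormedAddCommGroup F] [NormedSpace ℝ F] (h : Ω → F),
      IsTempered μ N h → ContDiffOn ℝ n (laplaceIntegral μ ℓ h) U := by
    intro n
    induction n with
    | zero =>
      intro F _ _ h hh
      simp only [Nat.cast_zero, contDiffOn_zero]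
      exact fun v hv => (hasFDerivAt_laplaceIntegral hℓ hh hv).continuousAt.continuousWithinAt
    | succ n ih =>
      intro F _ _ h hh
      rw [Nat.cast_succ, contDiffOn_succ_iff_fderiv_of_isOpen hℓ.isOpen]
      refine ⟨fun v hv =>
        (hasFDerivAt_laplaceIntegral hℓ hh hv).differentiableAt.differentiableWithinAt,
        by simp, ?_⟩
      exact (ih _ _ (hh.smulRight hℓ)).congr fun v hv =>
        (hasFDerivAt_laplaceIntegral hℓ hh hv).fderiv
  rw [contDiffOn_infty]
  exact fun n => key n F h hh

theorem laplaceIntegral_apply [CompleteSpace F] (hℓ : IsControlled μ N ℓ U)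
    (hh : IsTempered μ N h) {v : V} (hv : v ∈ U) (u : V) :
    laplaceIntegral μ ℓ (fun a => (ℓ a).smulRight (h a)) v u =
      laplaceIntegral μ ℓ (fun a => ℓ a u • h a) v := by
  rw [laplaceIntegral, ContinuousLinearMap.integral_apply (hℓ.integrable (hh.smulRight hℓ) hv)]
  rfl

end Laplace

/-! ### The quadratic form `|mz+n|²/y` and its derivatives in `z` -/

section QuadraticForm

/-- The nonzero vectors of `ℤ²`. -/
abbrev Lattice : Type := {p : ℤ × ℤ // p ≠ (0, 0)}

/-- The value at `p = (m, n)` of the binary quadratic form `a m² + 2 b m n + c n²`, as a linear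
form in the coefficients `(a, b, c)`. -/
noncomputable def quadForm (p : Lattice) : ℝ × ℝ × ℝ →L[ℝ] ℝ :=
  ((p.1.1 : ℝ) ^ 2) • ContinuousLinearMap.fst ℝ ℝ (ℝ × ℝ) +
    (2 * (p.1.1 : ℝ) * p.1.2) •
      (ContinuousLinearMap.fst ℝ ℝ ℝ).comp (ContinuousLinearMap.snd ℝ ℝ (ℝ × ℝ)) +
    ((p.1.2 : ℝ) ^ 2) •
      (ContinuousLinearMap.snd ℝ ℝ ℝ).comp (ContinuousLinearMap.snd ℝ ℝ (ℝ × ℝ))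

lemma quadForm_apply (p : Lattice) (v : ℝ × ℝ × ℝ) :
    quadForm p v = (p.1.1 : ℝ) ^ 2 * v.1 + 2 * p.1.1 * p.1.2 * v.2.1 + (p.1.2 : ℝ) ^ 2 * v.2.2 := by
  simp [quadForm]

/-- The squared Euclidean length of a lattice vector. -/
noncomputable def sqLength (p : Lattice) : ℝ := (p.1.1 : ℝ) ^ 2 + (p.1.2 : ℝ) ^ 2

lemma one_le_sqLength (p : Lattice) : 1 ≤ sqLength p := by
  obtain ⟨⟨m, n⟩, hp⟩ := p
  have : 1 ≤ m ^ 2 + n ^ 2 := by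
    by_contra hlt
    have hm : m = 0 := by nlinarith [sq_nonneg m, sq_nonneg n]
    have hn : n = 0 := by nlinarith [sq_nonneg m, sq_nonneg n]
    exact hp (by rw [hm, hn])
  have h : (1 : ℝ) ≤ (m : ℝ) ^ 2 + (n : ℝ) ^ 2 := by exact_mod_cast this
  exact h

lemma abs_quadForm_le (p : Lattice) (v : ℝ × ℝ × ℝ) : |quadForm p v| ≤ 2 * ‖v‖ * sqLength p := by
  have h1 : |v.1| ≤ ‖v‖ := norm_fst_le v
  have h2 : |v.2.1| ≤ ‖v‖ := (norm_fst_le v.2).trans (norm_snd_le v)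
  have h3 : |v.2.2| ≤ ‖v‖ := (norm_snd_le v.2).trans (norm_snd_le v)
  have h4 : |2 * (p.1.1 : ℝ) * p.1.2| ≤ sqLength p := by
    rw [abs_le, sqLength]
    constructor <;> nlinarith [sq_nonneg ((p.1.1 : ℝ) + p.1.2), sq_nonneg ((p.1.1 : ℝ) - p.1.2)]
  rw [quadForm_apply]
  calc _ ≤ |(p.1.1 : ℝ) ^ 2 * v.1| + |2 * (p.1.1 : ℝ) * p.1.2 * v.2.1| +
        |(p.1.2 : ℝ) ^ 2 * v.2.2| := abs_add_three _ _ _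
    _ ≤ (p.1.1 : ℝ) ^ 2 * ‖v‖ + sqLength p * ‖v‖ + (p.1.2 : ℝ) ^ 2 * ‖v‖ := by
        rw [abs_mul, abs_mul _ v.2.1, abs_mul _ v.2.2, abs_of_nonneg (sq_nonneg (p.1.1 : ℝ)),
          abs_of_nonneg (sq_nonneg (p.1.2 : ℝ))]
        gcongr
        exact zero_le_one.trans (one_le_sqLength p)
    _ = _ := by rw [sqLength]; ring

lemma norm_quadForm_le (p : Lattice) : ‖quadForm p‖ ≤ 2 * sqLength p :=
  ContinuousLinearMap.opNorm_le_bound _ (by linarith [one_le_sqLength p]) fun v =>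
    (abs_quadForm_le p v).trans_eq (by ring)

/-- The coefficients of binary quadratic forms that are bounded below by a positive multiple of
the Euclidean form on the lattice. -/
def posForms : Set (ℝ × ℝ × ℝ) := {v | ∃ ε : ℝ, 0 < ε ∧ ∀ p, ε * sqLength p ≤ quadForm p v}

lemma exists_le_quadForm_near {v : ℝ × ℝ × ℝ} (hv : v ∈ posForms) :
    ∃ ε : ℝ, 0 < ε ∧ ∃ s ∈ nhds v, ∀ p, ∀ u ∈ s, ε * sqLength p ≤ quadForm p u := by
  obtain ⟨ε, hε, h⟩ := hv
  -- By `abs_quadForm_le`, moving the coefficients by `ε/4` changes the form by at most `2 · ε/4`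
  -- times `sqLength`, leaving `ε/2`.
  refine ⟨ε / 2, by positivity, Metric.ball v (ε / 4), Metric.ball_mem_nhds _ (by positivity),
    fun p u hu => ?_⟩
  have h1 := abs_quadForm_le p (u - v)
  have h2 : ‖u - v‖ ≤ ε / 4 := by rw [← dist_eq_norm]; exact (Metric.mem_ball.1 hu).le
  have h3 := one_le_sqLength p
  have h4 : 2 * ‖u - v‖ * sqLength p ≤ 2 * (ε / 4) * sqLength p := by gcongr
  rw [map_sub] at h1
  have h5 := neg_le_of_abs_le h1
  linarith [h p]

lemma isOpen_posForms : IsOpen posForms := by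
  rw [isOpen_iff_mem_nhds]
  intro v hv
  obtain ⟨ε, hε, s, hs, h⟩ := exists_le_quadForm_near hv
  exact Filter.mem_of_superset hs fun u hu => ⟨ε, hε, fun p => h p u hu⟩

/-- The coefficients `(|z|²/y, x/y, 1/y)` of the quadratic form `|mz+n|²/y`. -/
noncomputable def gram (w : ℂ) : ℝ × ℝ × ℝ :=
  ((w.re ^ 2 + w.im ^ 2) / w.im, w.re / w.im, 1 / w.im)

lemma quadForm_gram (p : Lattice) (z : ℍ) :
    quadForm p (gram z) = ‖(p.1.1 : ℂ) * z + p.1.2‖ ^ 2 / z.im := by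
  have hy : z.im ≠ 0 := z.im_ne_zero
  rw [quadForm_apply, ← Complex.normSq_eq_norm_sq, Complex.normSq_apply]
  simp [gram]
  field_simp
  ring

/-- Positivity comes from `r z * max(|m|,|n|) ≤ |mz+n|`. The extra factor `1/2` reflects `m² + n² ≤
2 max(|m|,|n|)²`. -/
lemma gram_mem_posForms (z : ℍ) : gram z ∈ posForms := by
  refine ⟨EisensteinSeries.r z ^ 2 / z.im / 2, ?_, fun p => ?_⟩
  · have := EisensteinSeries.r_pos z
    have := z.im_pos
    positivity
  have hx : ![p.1.1, p.1.2] ≠ 0 := by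
    intro h
    exact p.2 (Prod.ext (by simpa using congrFun h 0) (by simpa using congrFun h 1))
  have h1 := EisensteinSeries.r_mul_max_le z hx
  have hr := EisensteinSeries.r_pos z
  have h2 : |(p.1.1 : ℝ)| ≤ ‖![p.1.1, p.1.2]‖ := by
    exact_mod_cast EisensteinSeries.abs_le_left_of_norm p.1.2 p.1.1
  have h3 : |(p.1.2 : ℝ)| ≤ ‖![p.1.1, p.1.2]‖ := by
    exact_mod_cast EisensteinSeries.abs_le_right_of_norm p.1.2 p.1.1
  have h4 : sqLength p ≤ 2 * ‖![p.1.1, p.1.2]‖ ^ 2 := by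
    have h5 := pow_le_pow_left₀ (abs_nonneg _) h2 2
    have h6 := pow_le_pow_left₀ (abs_nonneg _) h3 2
    rw [sq_abs] at h5 h6
    rw [sqLength]; linarith
  have h7 := pow_le_pow_left₀ (by positivity) h1 2
  rw [mul_pow] at h7
  simp only [Matrix.cons_val_zero, Matrix.cons_val_one] at h7
  rw [quadForm_gram]
  have hy := z.im_pos
  rw [div_div, div_mul_eq_mul_div, div_le_div_iff₀ (by positivity) hy]
  calc EisensteinSeries.r z ^ 2 * sqLength p * z.im
      ≤ EisensteinSeries.r z ^ 2 * (2 * ‖![p.1.1, p.1.2]‖ ^ 2) * z.im := by gcongr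
    _ = EisensteinSeries.r z ^ 2 * ‖![p.1.1, p.1.2]‖ ^ 2 * (2 * z.im) := by ring
    _ ≤ ‖(p.1.1 : ℂ) * z + p.1.2‖ ^ 2 * (z.im * 2) := by
        rw [mul_comm z.im]; gcongr

/-- The derivative of `gram` in the direction `1`. -/
noncomputable def gramX (w : ℂ) : ℝ × ℝ × ℝ := (2 * w.re / w.im, 1 / w.im, 0)

/-- The derivative of `gram` in the direction `i`. -/
noncomputable def gramY (w : ℂ) : ℝ × ℝ × ℝ :=
  (1 - w.re ^ 2 / w.im ^ 2, -w.re / w.im ^ 2, -1 / w.im ^ 2)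

section

variable {w : ℂ}

lemma contDiffAt_gram (hw : w.im ≠ 0) : ContDiffAt ℝ ∞ gram w := by
  have hx : ContDiffAt ℝ ∞ (fun w : ℂ => w.re) w := Complex.reCLM.contDiff.contDiffAt
  have hy : ContDiffAt ℝ ∞ (fun w : ℂ => w.im) w := Complex.imCLM.contDiff.contDiffAt
  exact (((hx.pow 2).add (hy.pow 2)).fun_div hy hw).prodMk
    ((hx.div hy hw).prodMk (contDiffAt_const.div hy hw))

lemma differentiableAt_gramX (hw : w.im ≠ 0) : DifferentiableAt ℝ gramX w := by
  have hx : ContDiffAt ℝ 1 (fun w : ℂ => w.re) w := Complex.reCLM.contDiff.contDiffAt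
  have hy : ContDiffAt ℝ 1 (fun w : ℂ => w.im) w := Complex.imCLM.contDiff.contDiffAt
  have h : ContDiffAt ℝ 1 gramX w := ((contDiffAt_const.mul hx).div hy hw).prodMk
    ((contDiffAt_const.div hy hw).prodMk contDiffAt_const)
  exact h.differentiableAt one_ne_zero

lemma differentiableAt_gramY (hw : w.im ≠ 0) : DifferentiableAt ℝ gramY w := by
  have hx : ContDiffAt ℝ 1 (fun w : ℂ => w.re) w := Complex.reCLM.contDiff.contDiffAt
  have hy : ContDiffAt ℝ 1 (fun w : ℂ => w.im) w := Complex.imCLM.contDiff.contDiffAt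
  have hw' : w.im ^ 2 ≠ 0 := pow_ne_zero 2 hw
  have h : ContDiffAt ℝ 1 gramY w :=
    (contDiffAt_const.sub ((hx.pow 2).div (hy.pow 2) hw')).prodMk
      ((hx.neg.div (hy.pow 2) hw').prodMk (contDiffAt_const.div (hy.pow 2) hw'))
  exact h.differentiableAt one_ne_zero

lemma fderiv_gram_one (hw : w.im ≠ 0) : fderiv ℝ gram w 1 = gramX w := by
  rw [← ((contDiffAt_gram hw).differentiableAt (by simp)).lineDeriv_eq_fderiv]
  refine HasLineDerivAt.lineDeriv (f' := gramX w) ?_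
  simp only [HasLineDerivAt, gram, Complex.add_re, Complex.add_im, Complex.real_smul, mul_one,
    Complex.ofReal_re, Complex.ofReal_im, add_zero, gramX]
  have h := (hasDerivAt_id (0 : ℝ)).const_add w.re
  refine HasDerivAt.prodMk ?_ (HasDerivAt.prodMk ?_ (hasDerivAt_const _ _))
  · refine HasDerivAt.congr_deriv (((h.fun_pow 2).add_const (w.im ^ 2)).div_const w.im) ?_
    simp
  · exact h.div_const _

lemma fderiv_gramX_one (hw : w.im ≠ 0) : fderiv ℝ gramX w 1 = (2 / w.im, 0, 0) := by
  rw [← (differentiableAt_gramX hw).lineDeriv_eq_fderiv]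
  refine HasLineDerivAt.lineDeriv ?_
  simp only [HasLineDerivAt, gramX, Complex.add_re, Complex.add_im, Complex.real_smul, mul_one,
    Complex.ofReal_re, Complex.ofReal_im, add_zero]
  have h := (hasDerivAt_id (0 : ℝ)).const_add w.re
  refine HasDerivAt.prodMk ?_ (HasDerivAt.prodMk (hasDerivAt_const _ _) (hasDerivAt_const _ _))
  refine HasDerivAt.congr_deriv ((h.const_mul 2).div_const w.im) ?_
  simp

lemma fderiv_gram_I (hw : w.im ≠ 0) : fderiv ℝ gram w Complex.I = gramY w := by
  rw [← ((contDiffAt_gram hw).differentiableAt (by simp)).lineDeriv_eq_fderiv]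
  refine HasLineDerivAt.lineDeriv (f' := gramY w) ?_
  simp only [HasLineDerivAt, gram, Complex.add_re, Complex.add_im, Complex.real_smul,
    Complex.re_ofReal_mul, Complex.im_ofReal_mul, Complex.I_re, Complex.I_im, mul_zero, mul_one,
    add_zero, gramY]
  have h := (hasDerivAt_id (0 : ℝ)).const_add w.im
  have h0 : w.im + id (0 : ℝ) ≠ 0 := by simpa using hw
  refine HasDerivAt.prodMk ?_ (HasDerivAt.prodMk ?_ ?_)
  · refine HasDerivAt.congr_deriv (((h.fun_pow 2).const_add (w.re ^ 2)).fun_div h h0) ?_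
    simp; field_simp; ring
  · refine HasDerivAt.congr_deriv ((hasDerivAt_const (0 : ℝ) w.re).fun_div h h0) ?_
    simp
  · refine HasDerivAt.congr_deriv ((hasDerivAt_const (0 : ℝ) (1 : ℝ)).fun_div h h0) ?_
    simp

lemma fderiv_gramY_I (hw : w.im ≠ 0) : fderiv ℝ gramY w Complex.I =
    (2 * w.re ^ 2 / w.im ^ 3, 2 * w.re / w.im ^ 3, 2 / w.im ^ 3) := by
  rw [← (differentiableAt_gramY hw).lineDeriv_eq_fderiv]
  refine HasLineDerivAt.lineDeriv ?_
  simp only [HasLineDerivAt, gramY, Complex.add_re, Complex.add_im, Complex.real_smul,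
    Complex.re_ofReal_mul, Complex.im_ofReal_mul, Complex.I_re, Complex.I_im, mul_zero, mul_one,
    add_zero]
  have h := ((hasDerivAt_id (0 : ℝ)).const_add w.im).fun_pow 2
  have h0 : (w.im + id (0 : ℝ)) ^ 2 ≠ 0 := by simpa using hw
  refine HasDerivAt.prodMk ?_ (HasDerivAt.prodMk ?_ ?_)
  · refine HasDerivAt.congr_deriv (((hasDerivAt_const (0 : ℝ) (w.re ^ 2)).fun_div h h0).const_sub 1) ?_
    simp; field_simp
  · refine HasDerivAt.congr_deriv ((hasDerivAt_const (0 : ℝ) (-w.re)).fun_div h h0) ?_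
    simp; field_simp
  · refine HasDerivAt.congr_deriv ((hasDerivAt_const (0 : ℝ) (-1 : ℝ)).fun_div h h0) ?_
    simp; field_simp

/-- The coefficient vector is an eigenvector: `y²(∂_x² + ∂_y²)` acts on it as 2. This gives the term
`2L` of `laplacianCoeff`. -/
lemma fderiv_gramX_add_gramY (hw : w.im ≠ 0) :
    fderiv ℝ gramX w 1 + fderiv ℝ gramY w Complex.I = (2 / w.im ^ 2) • gram w := by
  rw [fderiv_gramX_one hw, fderiv_gramY_I hw, gram]
  ext
  · simp; field_simp; ring
  · simp; field_simp
  · simp; field_simp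

/-- An eikonal identity, `y² |∇Q|² = Q²`, responsible for the term `L²` of `laplacianCoeff`. -/
lemma quadForm_gramX_gramY (hw : w.im ≠ 0) (p : Lattice) :
    w.im ^ 2 * (quadForm p (gramX w) ^ 2 + quadForm p (gramY w) ^ 2) = quadForm p (gram w) ^ 2 := by
  simp only [quadForm_apply, gramX, gramY, gram]
  field_simp
  ring

end

end QuadraticForm

/-! ### Theta series and their integrals as Laplace transforms -/

section ThetaSeries

open MeasureTheory Filter Topology

/-- Comparison with the sup-norm lattice sum of exponent `2σ > 2`. -/
lemma summable_sqLength_rpow {σ : ℝ} (hσ : 1 < σ) :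
    Summable fun p : Lattice => sqLength p ^ (-σ) := by
  have h := EisensteinSeries.summable_one_div_norm_rpow (k := 2 * σ) (by linarith)
  have hinj : Function.Injective (fun p : Lattice => ![p.1.1, p.1.2]) := by
    intro p q hpq
    exact Subtype.ext (Prod.ext (by simpa using congrFun hpq 0) (by simpa using congrFun hpq 1))
  refine (h.comp_injective hinj).of_nonneg_of_le (fun p => ?_) fun p => ?_
  · exact Real.rpow_nonneg (zero_le_one.trans (one_le_sqLength p)) _
  have h0 : ![p.1.1, p.1.2] ≠ 0 := by
    intro h
    exact p.2 (Prod.ext (by simpa using congrFun h 0) (by simpa using congrFun h 1))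
  have h1 : 0 < ‖![p.1.1, p.1.2]‖ := norm_pos_iff.2 h0
  have h2 : ‖![p.1.1, p.1.2]‖ ≤ √(sqLength p) := by
    refine (pi_norm_le_iff_of_nonneg (Real.sqrt_nonneg _)).2 fun i => ?_
    refine Real.le_sqrt_of_sq_le ?_
    rw [Int.norm_eq_abs, sq_abs, sqLength]
    fin_cases i <;> simp <;> positivity
  have h3 : ‖![p.1.1, p.1.2]‖ ^ 2 ≤ sqLength p := by
    rw [← Real.sq_sqrt (zero_le_one.trans (one_le_sqLength p))]
    gcongr
  simp only [Function.comp_apply]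
  rw [show -(2 * σ) = 2 * (-σ) by ring, Real.rpow_mul h1.le, Real.rpow_two]
  exact Real.rpow_le_rpow_of_nonpos (by positivity) h3 (by linarith)

lemma summable_exp_neg_sqLength {δ : ℝ} (hδ : 0 < δ) :
    Summable fun p : Lattice => Real.exp (-δ * sqLength p) := by
  -- Any exponent above 1 would do; `σ = 2` uses `(δx/2)² ≤ exp (δx)`.
  refine ((summable_sqLength_rpow (σ := 2) (by norm_num)).mul_left ((2 / δ) ^ 2)).of_nonneg_of_le
    (fun p => (Real.exp_pos _).le) fun p => ?_
  have h1 := one_le_sqLength p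
  have h2 : δ / 2 * sqLength p ≤ Real.exp (δ / 2 * sqLength p) :=
    (by linarith : δ / 2 * sqLength p ≤ δ / 2 * sqLength p + 1).trans (Real.add_one_le_exp _)
  have h3 : (δ / 2 * sqLength p) ^ 2 ≤ Real.exp (δ * sqLength p) := by
    calc _ ≤ Real.exp (δ / 2 * sqLength p) ^ 2 := by gcongr
      _ = _ := by rw [← Real.exp_nat_mul]; ring_nf
  rw [neg_mul, Real.exp_neg, Real.rpow_neg (by linarith), Real.rpow_two,
    ← inv_inv ((2 / δ) ^ 2), ← mul_inv]
  refine inv_anti₀ (by positivity) ?_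
  refine le_trans (le_of_eq ?_) h3
  field_simp

/-- The exponent `-π t Q(p)` as a linear form in the coefficients of the quadratic form `Q`. -/
noncomputable def thetaForm (a : Lattice × ℝ) : ℝ × ℝ × ℝ →L[ℝ] ℝ :=
  (-Real.pi * a.2) • quadForm a.1

lemma thetaForm_apply (p : Lattice) (t : ℝ) (v : ℝ × ℝ × ℝ) :
    thetaForm (p, t) v = -Real.pi * t * quadForm p v := rfl

/-- The weight `t |p|²` that controls the exponents `thetaForm`. -/
noncomputable def thetaWeight (a : Lattice × ℝ) : ℝ := a.2 * sqLength a.1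

/-- The coefficient family `κ` grows more slowly than each `exp (δ t |p|²)`. -/
structure IsSubexponential (κ : Lattice × ℝ → ℂ) : Prop where
  measurable : Measurable κ
  bound : ∀ δ : ℝ, 0 < δ → ∃ C : ℝ, 0 ≤ C ∧ ∀ p t, 0 < t →
    ‖κ (p, t)‖ ≤ C * Real.exp (δ * thetaWeight (p, t))

/-- The measure `w ν` on the positive half-line lives away from `0` and is integrable against
each `exp (-δ t)`. -/
structure IsAdmissible (ν : Measure ℝ) (w : ℝ → ℝ) : Prop where
  pos : ∃ c : ℝ, 0 < c ∧ ∀ᵐ t ∂ν, c ≤ t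
  aestronglyMeasurable : AEStronglyMeasurable w ν
  integrable : ∀ δ : ℝ, 0 < δ → Integrable (fun t => Real.exp (-δ * t) * ‖w t‖) ν

/-- The theta series with coefficients `κ` of the quadratic form attached to `z`. -/
noncomputable def thetaSeries (κ : Lattice × ℝ → ℂ) (z : ℍ) (t : ℝ) : ℂ :=
  ∑' p : Lattice, Real.exp (thetaForm (p, t) (gram z)) • κ (p, t)

/-- For `t ≥ c` the weight `t|p|²` dominates both `c|p|²` and `t`. Half the decay goes to each,
separating the lattice sum from the `t`-integral. -/
lemma exp_neg_thetaWeight_le {δ c t : ℝ} (hδ : 0 < δ) (hc : 0 < c) (ht : c ≤ t) (p : Lattice) :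
    Real.exp (-δ * thetaWeight (p, t)) ≤
      Real.exp (-(δ * c / 2) * sqLength p) * Real.exp (-(δ / 2) * t) := by
  rw [← Real.exp_add]
  refine Real.exp_le_exp.2 ?_
  have h1 := one_le_sqLength p
  have h2 : c * sqLength p ≤ t * sqLength p := by gcongr
  have h3 : t ≤ t * sqLength p := le_mul_of_one_le_right (hc.le.trans ht) h1
  simp only [thetaWeight]
  nlinarith

lemma exists_exp_thetaForm_le (z : ℍ) : ∃ δ : ℝ, 0 < δ ∧ ∀ (p : Lattice) (t : ℝ), 0 < t →
    Real.exp (thetaForm (p, t) (gram z)) ≤ Real.exp (-δ * thetaWeight (p, t)) := by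
  obtain ⟨ε, hε, h⟩ := gram_mem_posForms z
  refine ⟨Real.pi * ε, by positivity, fun p t ht => Real.exp_le_exp.2 ?_⟩
  have := h p
  have hpt : 0 < Real.pi * t := by positivity
  rw [thetaForm_apply, thetaWeight]
  nlinarith

/-- Termwise bound of a theta series with subexponential coefficients. -/
lemma IsSubexponential.exists_term_le {κ : Lattice × ℝ → ℂ} (hκ : IsSubexponential κ) (z : ℍ) :
    ∃ C δ : ℝ, 0 ≤ C ∧ 0 < δ ∧ ∀ (p : Lattice) (t : ℝ), 0 < t →
      ‖Real.exp (thetaForm (p, t) (gram z)) • κ (p, t)‖ ≤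
        C * Real.exp (-δ * thetaWeight (p, t)) := by
  obtain ⟨δ, hδ, h⟩ := exists_exp_thetaForm_le z
  obtain ⟨C, hC, hκC⟩ := hκ.bound (δ / 2) (by positivity)
  refine ⟨C, δ / 2, hC, by positivity, fun p t ht => ?_⟩
  rw [norm_smul, Real.norm_of_nonneg (Real.exp_pos _).le]
  calc _ ≤ Real.exp (-δ * thetaWeight (p, t)) * (C * Real.exp (δ / 2 * thetaWeight (p, t))) := by
        gcongr
        · exact Real.exp_le_exp.1 (h p t ht)
        · exact hκC p t ht
    _ = C * Real.exp (-δ * thetaWeight (p, t) + δ / 2 * thetaWeight (p, t)) := by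
        rw [Real.exp_add]; ring
    _ = _ := by ring_nf

lemma IsSubexponential.summable_norm {κ : Lattice × ℝ → ℂ} (hκ : IsSubexponential κ) (z : ℍ) {t : ℝ}
    (ht : 0 < t) :
    Summable fun p : Lattice => ‖Real.exp (thetaForm (p, t) (gram z)) • κ (p, t)‖ := by
  obtain ⟨C, δ, hC, hδ, h⟩ := hκ.exists_term_le z
  refine ((summable_exp_neg_sqLength (δ := δ * t) (by positivity)).mul_left C).of_nonneg_of_le
    (fun p => norm_nonneg _) fun p => (h p t ht).trans_eq ?_
  simp only [thetaWeight]; ring_nf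

lemma IsSubexponential.hasSum {κ : Lattice × ℝ → ℂ} (hκ : IsSubexponential κ) (z : ℍ) {t : ℝ}
    (ht : 0 < t) :
    HasSum (fun p : Lattice => Real.exp (thetaForm (p, t) (gram z)) • κ (p, t))
      (thetaSeries κ z t) :=
  (hκ.summable_norm z ht).of_norm.hasSum

/-- Exponential decay of theta series over the nonzero lattice vectors. -/
lemma IsSubexponential.exists_norm_thetaSeries_le {κ : Lattice × ℝ → ℂ} (hκ : IsSubexponential κ)
    (z : ℍ) : ∃ C δ : ℝ, 0 < δ ∧ ∀ t : ℝ, 1 ≤ t →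
      ‖thetaSeries κ z t‖ ≤ C * Real.exp (-δ * t) := by
  obtain ⟨C, δ, hC, hδ, h⟩ := hκ.exists_term_le z
  have hs := summable_exp_neg_sqLength (δ := δ * 1 / 2) (by positivity)
  refine ⟨C * ∑' p : Lattice, Real.exp (-(δ * 1 / 2) * sqLength p), δ / 2, by positivity,
    fun t ht => ?_⟩
  have ht0 : 0 < t := zero_lt_one.trans_le ht
  refine (norm_tsum_le_tsum_norm (hκ.summable_norm z ht0)).trans ?_
  rw [mul_assoc, ← tsum_mul_right, ← tsum_mul_left]
  refine (hκ.summable_norm z ht0).tsum_le_tsum (fun p => ?_) ((hs.mul_right _).mul_left _)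
  refine (h p t ht0).trans ?_
  gcongr
  exact exp_neg_thetaWeight_le hδ one_pos ht p

lemma ae_prod_snd {ν : Measure ℝ} {P : ℝ → Prop} (h : ∀ᵐ t ∂ν, P t) :
    ∀ᵐ a ∂((Measure.count : Measure Lattice).prod ν), P a.2 :=
  Measure.quasiMeasurePreserving_snd.ae h

variable {ν : Measure ℝ} {w : ℝ → ℝ}

lemma measurable_thetaWeight : Measurable thetaWeight :=
  measurable_from_prod_countable_right fun p => by
    simp only [thetaWeight]; fun_prop

lemma stronglyMeasurable_thetaForm : StronglyMeasurable thetaForm := by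
  have h : ∀ c : Lattice → ℝ, StronglyMeasurable fun a : Lattice × ℝ => c a.1 := fun c =>
    ((measurable_of_countable c).comp measurable_fst).stronglyMeasurable
  have h2 : StronglyMeasurable fun a : Lattice × ℝ => -Real.pi * a.2 :=
    (measurable_snd.const_mul _).stronglyMeasurable
  exact h2.smul ((((h fun p => (p.1.1 : ℝ) ^ 2).smul_const _).add
    ((h fun p => 2 * (p.1.1 : ℝ) * p.1.2).smul_const _)).add
    ((h fun p => (p.1.2 : ℝ) ^ 2).smul_const _))

lemma IsAdmissible.isControlled (hw : IsAdmissible ν w) :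
    IsControlled ((Measure.count : Measure Lattice).prod ν) thetaWeight thetaForm posForms := by
  obtain ⟨c, hc, hpos⟩ := hw.pos
  have hae := ae_prod_snd hpos
  refine ⟨measurable_thetaWeight.aestronglyMeasurable,
    stronglyMeasurable_thetaForm.aestronglyMeasurable, isOpen_posForms, ?_, ?_, ?_⟩
  · filter_upwards [hae] with a ha
    exact mul_nonneg (hc.le.trans ha) (zero_le_one.trans (one_le_sqLength _))
  · refine ⟨Real.pi * 2, by positivity, ?_⟩
    filter_upwards [hae] with a ha
    have h1 := norm_quadForm_le a.1
    have h2 : 0 < a.2 := hc.trans_le ha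
    rw [thetaForm, norm_smul, Real.norm_eq_abs, abs_mul, abs_neg, abs_of_pos Real.pi_pos,
      abs_of_pos h2, thetaWeight]
    calc _ ≤ Real.pi * a.2 * (2 * sqLength a.1) := by gcongr
      _ = _ := by ring
  · intro v hv
    obtain ⟨ε, hε, s, hs, h⟩ := exists_le_quadForm_near hv
    refine ⟨Real.pi * ε, by positivity, s, hs, ?_⟩
    filter_upwards [hae] with a ha u hu
    have h2 : 0 < a.2 := hc.trans_le ha
    have h3 := h a.1 u hu
    have hpt : 0 < Real.pi * a.2 := by positivity
    change -Real.pi * a.2 * quadForm a.1 u ≤ _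
    rw [thetaWeight]
    nlinarith

lemma IsAdmissible.isTempered (hw : IsAdmissible ν w) {κ : Lattice × ℝ → ℂ}
    (hκ : IsSubexponential κ) :
    IsTempered ((Measure.count : Measure Lattice).prod ν) thetaWeight
      (fun a => κ a * (w a.2 : ℂ)) := by
  have hm : AEStronglyMeasurable (fun a : Lattice × ℝ => κ a * (w a.2 : ℂ))
      ((Measure.count : Measure Lattice).prod ν) :=
    hκ.measurable.aestronglyMeasurable.mul
      (Complex.continuous_ofReal.comp_aestronglyMeasurable hw.aestronglyMeasurable.comp_snd)
  refine ⟨hm, fun δ hδ => ?_⟩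
  obtain ⟨c, hc, hpos⟩ := hw.pos
  obtain ⟨C, hC, hκC⟩ := hκ.bound (δ / 2) (by positivity)
  have hs := summable_exp_neg_sqLength (δ := δ / 2 * c / 2) (by positivity)
  have hi : Integrable (fun p : Lattice => C * Real.exp (-(δ / 2 * c / 2) * sqLength p))
      Measure.count := integrable_count_iff.2 (hs.mul_left C).norm
  refine (hi.mul_prod (hw.integrable (δ / 2 / 2) (by positivity))).mono' ?_ ?_
  · exact (Real.continuous_exp.comp_aestronglyMeasurable
      (measurable_thetaWeight.const_mul _).aestronglyMeasurable).mul hm.norm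
  · filter_upwards [ae_prod_snd hpos] with a ha
    obtain ⟨p, t⟩ := a
    have ht : 0 < t := hc.trans_le ha
    rw [norm_mul, norm_norm, norm_mul, Complex.norm_real, Real.norm_of_nonneg (Real.exp_pos _).le]
    have h1 := hκC p t ht
    have h2 := exp_neg_thetaWeight_le (δ := δ / 2) (by positivity) hc ha p
    calc Real.exp (-δ * thetaWeight (p, t)) * (‖κ (p, t)‖ * ‖w t‖)
        ≤ Real.exp (-δ * thetaWeight (p, t)) *
          (C * Real.exp (δ / 2 * thetaWeight (p, t)) * ‖w t‖) := by gcongr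
      _ = C * Real.exp (-δ * thetaWeight (p, t) + δ / 2 * thetaWeight (p, t)) * ‖w t‖ := by
          rw [Real.exp_add]; ring
      _ = C * Real.exp (-(δ / 2) * thetaWeight (p, t)) * ‖w t‖ := by ring_nf
      _ ≤ C * (Real.exp (-(δ / 2 * c / 2) * sqLength p) * Real.exp (-(δ / 2 / 2) * t)) * ‖w t‖ := by
          gcongr
      _ = _ := by ring

/-- Fubini for counting measure times `ν`. It identifies the integral of a theta series with a
Laplace transform evaluated at `gram z`. -/
lemma IsAdmissible.integral_thetaSeries [SFinite ν] (hw : IsAdmissible ν w) {κ : Lattice × ℝ → ℂ}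
    (hκ : IsSubexponential κ) (z : ℍ) :
    Integrable (fun t => thetaSeries κ z t * (w t : ℂ)) ν ∧
    laplaceIntegral ((Measure.count : Measure Lattice).prod ν) thetaForm
      (fun a => κ a * (w a.2 : ℂ)) (gram z) = ∫ t, thetaSeries κ z t * (w t : ℂ) ∂ν := by
  have hint := hw.isControlled.integrable (hw.isTempered hκ) (gram_mem_posForms z)
  have hae : (fun t => ∫ p : Lattice, Real.exp (thetaForm (p, t) (gram z)) •
      (κ (p, t) * (w t : ℂ)) ∂Measure.count) =ᵐ[ν] fun t => thetaSeries κ z t * (w t : ℂ) := by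
    filter_upwards [hint.prod_left_ae] with t ht
    rw [integral_countable ht, thetaSeries, ← tsum_mul_right]
    refine tsum_congr fun p => ?_
    simp [Measure.real, mul_assoc]
  refine ⟨hint.integral_prod_right.congr hae, ?_⟩
  rw [laplaceIntegral, integral_prod_symm _ hint]
  exact integral_congr_ae hae

end ThetaSeries

/-! ### Action of `ξ₀` and `Δ₀` on theta integrals -/

section ThetaDerivatives

open MeasureTheory Filter Topology

lemma isSubexponential_const (c : ℂ) : IsSubexponential fun _ => c := by
  refine ⟨measurable_const, fun δ hδ => ⟨‖c‖, norm_nonneg _, fun p t ht => ?_⟩⟩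
  have h : 0 ≤ thetaWeight (p, t) := mul_nonneg ht.le (zero_le_one.trans (one_le_sqLength p))
  exact le_mul_of_one_le_right (norm_nonneg _) (Real.one_le_exp (by positivity))

lemma IsSubexponential.add {κ κ' : Lattice × ℝ → ℂ} (h : IsSubexponential κ)
    (h' : IsSubexponential κ') : IsSubexponential fun a => κ a + κ' a := by
  refine ⟨h.measurable.add h'.measurable, fun δ hδ => ?_⟩
  obtain ⟨C, hC, hκ⟩ := h.bound δ hδ
  obtain ⟨C', hC', hκ'⟩ := h'.bound δ hδ
  refine ⟨C + C', by positivity, fun p t ht => (norm_add_le _ _).trans ?_⟩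
  rw [add_mul]
  exact add_le_add (hκ p t ht) (hκ' p t ht)

lemma IsSubexponential.mul {κ κ' : Lattice × ℝ → ℂ} (h : IsSubexponential κ)
    (h' : IsSubexponential κ') : IsSubexponential fun a => κ a * κ' a := by
  refine ⟨h.measurable.mul h'.measurable, fun δ hδ => ?_⟩
  obtain ⟨C, hC, hκ⟩ := h.bound (δ / 2) (by positivity)
  obtain ⟨C', hC', hκ'⟩ := h'.bound (δ / 2) (by positivity)
  refine ⟨C * C', by positivity, fun p t ht => ?_⟩
  rw [norm_mul]
  calc _ ≤ (C * Real.exp (δ / 2 * thetaWeight (p, t))) *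
        (C' * Real.exp (δ / 2 * thetaWeight (p, t))) := by
        gcongr
        · exact hκ p t ht
        · exact hκ' p t ht
    _ = C * C' * Real.exp (δ / 2 * thetaWeight (p, t) + δ / 2 * thetaWeight (p, t)) := by
        rw [Real.exp_add]; ring
    _ = _ := by ring_nf

/-- Growth is at most linear in `t|p|²`, so every factor brought down by differentiation keeps
coefficients subexponential. -/
lemma isSubexponential_thetaForm (u : ℝ × ℝ × ℝ) :
    IsSubexponential fun a => ((thetaForm a u : ℝ) : ℂ) := by
  refine ⟨?_, fun δ hδ => ?_⟩
  · exact Complex.measurable_ofReal.comp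
      ((ContinuousLinearMap.apply ℝ ℝ u).continuous.comp_stronglyMeasurable
        stronglyMeasurable_thetaForm).measurable
  · refine ⟨Real.pi * (2 * ‖u‖) / δ, by positivity, fun p t ht => ?_⟩
    have h1 : δ * thetaWeight (p, t) ≤ Real.exp (δ * thetaWeight (p, t)) :=
      (by linarith : δ * thetaWeight (p, t) ≤ δ * thetaWeight (p, t) + 1).trans
        (Real.add_one_le_exp _)
    rw [Complex.norm_real, Real.norm_eq_abs, thetaForm_apply, abs_mul, abs_mul, abs_neg,
      abs_of_pos Real.pi_pos, abs_of_pos ht]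
    calc Real.pi * t * |quadForm p u| ≤ Real.pi * t * (2 * ‖u‖ * sqLength p) := by
          gcongr; exact abs_quadForm_le p u
      _ = Real.pi * (2 * ‖u‖) / δ * (δ * thetaWeight (p, t)) := by
          rw [thetaWeight]; field_simp
      _ ≤ _ := by gcongr

/-- The coefficients of the theta series obtained by applying `ξ₀`. -/
noncomputable def xiCoeff (z : ℍ) (a : Lattice × ℝ) : ℂ :=
  Real.pi * a.2 * ((a.1.1.1 : ℂ) * (starRingEnd ℂ) (z : ℂ) + a.1.1.2) ^ 2 / (z.im : ℂ) ^ 2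

/-- The coefficients of the theta series obtained by applying `Δ₀`. -/
noncomputable def laplacianCoeff (z : ℍ) (a : Lattice × ℝ) : ℂ :=
  ((thetaForm a (gram z) : ℝ) : ℂ) * ((thetaForm a (gram z) : ℝ) : ℂ) +
    2 * ((thetaForm a (gram z) : ℝ) : ℂ)

/-- For real `L`, `ξ₀ exp L = (i L_x + L_y) exp L`; the right side is that factor and `xiCoeff` is
its closed form. -/
lemma xiCoeff_eq (z : ℍ) : xiCoeff z = fun a =>
    Complex.I * ((thetaForm a (gramX z) : ℝ) : ℂ) + ((thetaForm a (gramY z) : ℝ) : ℂ) := by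
  funext a
  obtain ⟨p, t⟩ := a
  have hy : (z.im : ℂ) ≠ 0 := by exact_mod_cast z.im_ne_zero
  have hz : (starRingEnd ℂ) (z : ℂ) = (z.re : ℂ) - Complex.I * z.im := by
    apply Complex.ext <;> simp
  simp only [xiCoeff, thetaForm_apply, quadForm_apply, gramX, gramY, hz, UpperHalfPlane.coe_re,
    UpperHalfPlane.coe_im]
  push_cast
  field_simp
  ring_nf
  simp only [Complex.I_sq]
  ring

lemma isSubexponential_xiCoeff (z : ℍ) : IsSubexponential (xiCoeff z) := by
  rw [xiCoeff_eq]
  exact ((isSubexponential_const _).mul (isSubexponential_thetaForm _)).add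
    (isSubexponential_thetaForm _)

lemma isSubexponential_laplacianCoeff (z : ℍ) : IsSubexponential (laplacianCoeff z) :=
  ((isSubexponential_thetaForm _).mul (isSubexponential_thetaForm _)).add
    ((isSubexponential_const _).mul (isSubexponential_thetaForm _))

variable {ν : Measure ℝ} {w : ℝ → ℝ}

/-- The integral of a theta series with coefficients `κ` against the measure `w ν`. -/
noncomputable def thetaIntegral (ν : Measure ℝ) (w : ℝ → ℝ) (κ : Lattice × ℝ → ℂ) (z : ℍ) : ℂ :=
  ∫ t, thetaSeries κ z t * (w t : ℂ) ∂ν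

lemma thetaIntegral_const_mul (κ : Lattice × ℝ → ℂ) (c : ℂ) (z : ℍ) :
    thetaIntegral ν w (fun a => c * κ a) z = c * thetaIntegral ν w κ z := by
  rw [thetaIntegral, thetaIntegral, ← integral_const_mul]
  refine integral_congr_ae (Eventually.of_forall fun t => ?_)
  simp only [thetaSeries, ← tsum_mul_left, ← tsum_mul_right, Complex.real_smul]
  exact tsum_congr fun p => by ring

/-- Reality of coefficients and weight is what makes the conjugation in `ξ₀` harmless. -/
lemma conj_thetaIntegral_ofReal (κ : Lattice × ℝ → ℝ) (z : ℍ) :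
    (starRingEnd ℂ) (thetaIntegral ν w (fun a => (κ a : ℂ)) z) =
      thetaIntegral ν w (fun a => (κ a : ℂ)) z := by
  rw [thetaIntegral, ← integral_conj]
  refine integral_congr_ae (Eventually.of_forall fun t => ?_)
  simp only [thetaSeries, map_mul, Complex.conj_tsum, Complex.real_smul, Complex.conj_ofReal]

variable [SFinite ν]

lemma IsAdmissible.thetaIntegral_add (hw : IsAdmissible ν w) {κ κ' : Lattice × ℝ → ℂ}
    (h : IsSubexponential κ) (h' : IsSubexponential κ') (z : ℍ) :
    thetaIntegral ν w (fun a => κ a + κ' a) z = thetaIntegral ν w κ z + thetaIntegral ν w κ' z := by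
  rw [thetaIntegral, thetaIntegral, thetaIntegral, ← (hw.integral_thetaSeries h z).2,
    ← (hw.integral_thetaSeries h' z).2, ← (hw.integral_thetaSeries (h.add h') z).2]
  simp only [laplaceIntegral, add_mul, smul_add]
  exact integral_add (hw.isControlled.integrable (hw.isTempered h) (gram_mem_posForms z))
    (hw.isControlled.integrable (hw.isTempered h') (gram_mem_posForms z))

/-- The derivative of a theta integral as a function of the coefficients of the form. -/
noncomputable def thetaGradient (ν : Measure ℝ) (w : ℝ → ℝ) (κ : Lattice × ℝ → ℂ) :
    ℝ × ℝ × ℝ → (ℝ × ℝ × ℝ →L[ℝ] ℂ) :=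
  laplaceIntegral ((Measure.count : Measure Lattice).prod ν) thetaForm
    (fun a => (thetaForm a).smulRight (κ a * (w a.2 : ℂ)))

lemma IsAdmissible.thetaGradient_apply (hw : IsAdmissible ν w) {κ : Lattice × ℝ → ℂ}
    (h : IsSubexponential κ) (z : ℍ) (u : ℝ × ℝ × ℝ) :
    thetaGradient ν w κ (gram z) u =
      thetaIntegral ν w (fun a => ((thetaForm a u : ℝ) : ℂ) * κ a) z := by
  rw [thetaGradient, laplaceIntegral_apply hw.isControlled (hw.isTempered h) (gram_mem_posForms z),
    thetaIntegral, ← (hw.integral_thetaSeries ((isSubexponential_thetaForm u).mul h) z).2]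
  simp only [Complex.real_smul, mul_assoc]

lemma IsAdmissible.fderiv_thetaGradient (hw : IsAdmissible ν w) {κ : Lattice × ℝ → ℂ}
    (h : IsSubexponential κ) (z : ℍ) (u v : ℝ × ℝ × ℝ) :
    fderiv ℝ (thetaGradient ν w κ) (gram z) u v = thetaIntegral ν w
      (fun a => ((thetaForm a v : ℝ) : ℂ) * (((thetaForm a u : ℝ) : ℂ) * κ a)) z := by
  have ht := (hw.isTempered h).smulRight hw.isControlled
  rw [thetaGradient, (hasFDerivAt_laplaceIntegral hw.isControlled ht (gram_mem_posForms z)).fderiv,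
    laplaceIntegral_apply hw.isControlled ht (gram_mem_posForms z),
    ← hw.thetaGradient_apply ((isSubexponential_thetaForm u).mul h) z v, thetaGradient]
  congr 2
  funext a
  refine ContinuousLinearMap.ext fun x => ?_
  simp
  ring

lemma IsAdmissible.extend_thetaIntegral (hw : IsAdmissible ν w) {κ : Lattice × ℝ → ℂ}
    (h : IsSubexponential κ) (z : ℍ) :
    extend (thetaIntegral ν w κ) =ᶠ[𝓝 (z : ℂ)] fun x =>
      laplaceIntegral ((Measure.count : Measure Lattice).prod ν) thetaForm
        (fun a => κ a * (w a.2 : ℂ)) (gram x) := by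
  filter_upwards [halfPlane_mem_nhds z] with x hx
  exact (extend_coe (thetaIntegral ν w κ) ⟨x, hx⟩).trans (hw.integral_thetaSeries h ⟨x, hx⟩).2.symm

lemma IsAdmissible.isSmooth_thetaIntegral (hw : IsAdmissible ν w) {κ : Lattice × ℝ → ℂ}
    (h : IsSubexponential κ) : IsSmooth (thetaIntegral ν w κ) :=
  isSmooth_of_contDiffAt fun z => ContDiffAt.congr_of_eventuallyEq
    (((contDiffOn_laplaceIntegral hw.isControlled (hw.isTempered h)).contDiffAt
      (isOpen_posForms.mem_nhds (gram_mem_posForms z))).comp (z : ℂ)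
        (contDiffAt_gram z.im_ne_zero)) (hw.extend_thetaIntegral h z)

lemma IsAdmissible.dirDeriv_thetaIntegral (hw : IsAdmissible ν w) {κ : Lattice × ℝ → ℂ}
    (h : IsSubexponential κ) (v : ℂ) (z : ℍ) :
    dirDeriv v (thetaIntegral ν w κ) z = thetaGradient ν w κ (gram z) (fderiv ℝ gram z v) := by
  rw [(hw.isSmooth_thetaIntegral h).dirDeriv_eq, (hw.extend_thetaIntegral h z).fderiv_eq]
  have h1 := hasFDerivAt_laplaceIntegral hw.isControlled (hw.isTempered h) (gram_mem_posForms z)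
  have h2 := ((contDiffAt_gram z.im_ne_zero).differentiableAt (by simp)).hasFDerivAt
  exact congrArg (fun L => L v) (h1.comp (z : ℂ) h2).fderiv

/-- Chain and product rule for `x ↦ thetaGradient (gram x) (g x)`. An explicit `g` on the whole
half-plane is needed to differentiate the direction vector too. -/
lemma IsAdmissible.dirDeriv_dirDeriv_thetaIntegral (hw : IsAdmissible ν w) {κ : Lattice × ℝ → ℂ}
    (h : IsSubexponential κ) {v : ℂ} {g : ℂ → ℝ × ℝ × ℝ} (z : ℍ)
    (hg : ∀ x ∈ halfPlane, fderiv ℝ gram x v = g x) (hgd : DifferentiableAt ℝ g z) :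
    dirDeriv v (dirDeriv v (thetaIntegral ν w κ)) z =
      thetaGradient ν w κ (gram z) (fderiv ℝ g z v) +
        fderiv ℝ (thetaGradient ν w κ) (gram z) (g z) (g z) := by
  have hs := hw.isSmooth_thetaIntegral h
  have he : extend (dirDeriv v (thetaIntegral ν w κ)) =ᶠ[𝓝 (z : ℂ)] fun x =>
      thetaGradient ν w κ (gram x) (g x) := by
    filter_upwards [halfPlane_mem_nhds z] with x hx
    refine (extend_coe (dirDeriv v (thetaIntegral ν w κ)) ⟨x, hx⟩).trans ?_
    rw [hw.dirDeriv_thetaIntegral h, ← hg x hx]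
  have h1 : HasFDerivAt (thetaGradient ν w κ) (fderiv ℝ (thetaGradient ν w κ) (gram z)) (gram z) :=
    (hasFDerivAt_laplaceIntegral hw.isControlled ((hw.isTempered h).smulRight hw.isControlled)
      (gram_mem_posForms z)).differentiableAt.hasFDerivAt
  have h2 := ((contDiffAt_gram z.im_ne_zero).differentiableAt (by simp)).hasFDerivAt
  have h3 := (h1.comp (z : ℂ) h2).clm_apply hgd.hasFDerivAt
  rw [(hs.dirDeriv v).dirDeriv_eq, he.fderiv_eq]
  refine (congrArg (fun L => L v) h3.fderiv).trans ?_
  have hgz : fderiv ℝ gram z v = g z := hg z z.im_pos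
  simp [hgz]

/-- `Δ₀` acts under the integral of a theta series. -/
theorem IsAdmissible.laplacian_thetaIntegral (hw : IsAdmissible ν w) (z : ℍ) :
    laplacian 0 (thetaIntegral ν w fun _ => 1) z = thetaIntegral ν w (laplacianCoeff z) z := by
  have h := isSubexponential_const 1
  have hf := isSubexponential_thetaForm
  have hy : (z : ℂ).im ≠ 0 := z.im_ne_zero
  have hyC : (z.im : ℂ) ≠ 0 := by exact_mod_cast z.im_ne_zero
  rw [laplacian_eq, hw.dirDeriv_dirDeriv_thetaIntegral h z
      (fun x hx => fderiv_gram_one (ne_of_gt hx)) (differentiableAt_gramX hy),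
    hw.dirDeriv_dirDeriv_thetaIntegral h z
      (fun x hx => fderiv_gram_I (ne_of_gt hx)) (differentiableAt_gramY hy),
    hw.fderiv_thetaGradient h, hw.fderiv_thetaGradient h]
  have h1 : thetaGradient ν w (fun _ => 1) (gram z) (fderiv ℝ gramX z 1) +
      thetaGradient ν w (fun _ => 1) (gram z) (fderiv ℝ gramY z Complex.I) =
      (2 / (z.im : ℂ) ^ 2) * thetaIntegral ν w (fun a => ((thetaForm a (gram z) : ℝ) : ℂ)) z := by
    rw [← map_add, fderiv_gramX_add_gramY hy, map_smul, hw.thetaGradient_apply h]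
    simp
  have hsq : ∀ u, IsSubexponential fun a => ((thetaForm a u : ℝ) : ℂ) *
      (((thetaForm a u : ℝ) : ℂ) * 1) := fun u => (hf u).mul ((hf u).mul h)
  have h2 : (z.im : ℂ) ^ 2 * (thetaIntegral ν w (fun a => ((thetaForm a (gramX z) : ℝ) : ℂ) *
      (((thetaForm a (gramX z) : ℝ) : ℂ) * 1)) z +
      thetaIntegral ν w (fun a => ((thetaForm a (gramY z) : ℝ) : ℂ) *
      (((thetaForm a (gramY z) : ℝ) : ℂ) * 1)) z) =
      thetaIntegral ν w (fun a => ((thetaForm a (gram z) : ℝ) : ℂ) *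
        ((thetaForm a (gram z) : ℝ) : ℂ)) z := by
    rw [← hw.thetaIntegral_add (hsq _) (hsq _), ← thetaIntegral_const_mul]
    congr 1
    funext a
    obtain ⟨p, t⟩ := a
    have := quadForm_gramX_gramY hy p
    simp only [thetaForm_apply]
    norm_cast
    rw [UpperHalfPlane.coe_im] at this
    linear_combination (Real.pi * t) ^ 2 * this
  have h3 : thetaIntegral ν w (laplacianCoeff z) z =
      thetaIntegral ν w (fun a => ((thetaForm a (gram z) : ℝ) : ℂ) *
        ((thetaForm a (gram z) : ℝ) : ℂ)) z +
      2 * thetaIntegral ν w (fun a => ((thetaForm a (gram z) : ℝ) : ℂ)) z := by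
    rw [← thetaIntegral_const_mul, ← hw.thetaIntegral_add ((hf _).mul (hf _))
      ((isSubexponential_const 2).mul (hf _))]
    rfl
  rw [h3, ← h2]
  have h4 : (z.im : ℂ) ^ 2 * ((2 / (z.im : ℂ) ^ 2) *
      thetaIntegral ν w (fun a => ((thetaForm a (gram z) : ℝ) : ℂ)) z) =
      2 * thetaIntegral ν w (fun a => ((thetaForm a (gram z) : ℝ) : ℂ)) z := by
    field_simp
  rw [← h4, ← h1]
  push_cast
  ring

/-- `ξ₀` acts under the integral of a theta series. -/
theorem IsAdmissible.xi_thetaIntegral (hw : IsAdmissible ν w) (z : ℍ) :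
    xi 0 (thetaIntegral ν w fun _ => 1) z = thetaIntegral ν w (xiCoeff z) z := by
  have h := isSubexponential_const 1
  have hf := isSubexponential_thetaForm
  have hy : (z : ℂ).im ≠ 0 := z.im_ne_zero
  rw [xi, dbar_eq, hw.dirDeriv_thetaIntegral h, hw.dirDeriv_thetaIntegral h, fderiv_gram_one hy,
    fderiv_gram_I hy, hw.thetaGradient_apply h, hw.thetaGradient_apply h, xiCoeff_eq,
    hw.thetaIntegral_add ((isSubexponential_const _).mul (hf _)) (hf _), thetaIntegral_const_mul]
  simp only [mul_one, map_mul, map_add, conj_thetaIntegral_ofReal, Complex.conj_I, map_div₀,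
    map_one, map_ofNat, zpow_zero]
  ring_nf
  simp only [Complex.I_sq]
  ring

end ThetaDerivatives

/-! ### Poisson summation and the transformation `t ↦ 1/t` -/

section FunctionalEquation

open MeasureTheory Filter Topology

lemma summable_of_summable_lattice {f : ℤ × ℤ → ℂ} (hf : Summable fun p : Lattice => f p.1) :
    Summable f :=
  (Set.finite_singleton ((0, 0) : ℤ × ℤ)).summable_compl_iff.1 hf

lemma tsum_eq_add_tsum_lattice {f : ℤ × ℤ → ℂ} (hf : Summable f) :
    ∑' p, f p = f (0, 0) + ∑' p : Lattice, f p.1 := by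
  rw [← hf.tsum_subtype_add_tsum_subtype_compl ({(0, 0)} : Set (ℤ × ℤ)), tsum_singleton]
  rfl

/-- Partial Poisson dual of the Gaussian on the lattice `ℤ z + ℤ`. -/
noncomputable def dualGaussian (z : ℍ) (t : ℝ) (p : ℤ × ℤ) : ℂ :=
  Complex.exp (-Real.pi * (z.im / t : ℝ) * p.2 ^ 2 - Real.pi * (t * z.im : ℝ) * p.1 ^ 2 -
    2 * Real.pi * Complex.I * z.re * p.1 * p.2)

/-- After Poisson summation in one variable only, inverting `t` exchanges the two indices; this
symmetry yields the transformation law. -/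
lemma dualGaussian_inv (z : ℍ) {t : ℝ} (p : ℤ × ℤ) :
    dualGaussian z t⁻¹ p = dualGaussian z t p.swap := by
  simp only [dualGaussian, Prod.fst_swap, Prod.snd_swap]
  congr 1
  push_cast
  rw [div_inv_eq_mul]
  ring

lemma norm_dualGaussian (z : ℍ) (t : ℝ) (p : ℤ × ℤ) : ‖dualGaussian z t p‖ =
    Real.exp (-Real.pi * (z.im / t * (p.2 : ℝ) ^ 2 + t * z.im * (p.1 : ℝ) ^ 2)) := by
  have h : (-Real.pi * ((z.im / t : ℝ) : ℂ) * (p.2 : ℂ) ^ 2 -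
      Real.pi * ((t * z.im : ℝ) : ℂ) * (p.1 : ℂ) ^ 2 -
      2 * Real.pi * Complex.I * z.re * p.1 * p.2) =
      ((-Real.pi * (z.im / t * (p.2 : ℝ) ^ 2 + t * z.im * (p.1 : ℝ) ^ 2) : ℝ) : ℂ) +
      ((-2 * Real.pi * z.re * p.1 * p.2 : ℝ) : ℂ) * Complex.I := by
    push_cast; ring
  rw [dualGaussian, h, Complex.exp_add, norm_mul, Complex.norm_exp_ofReal_mul_I, mul_one,
    Complex.norm_exp, Complex.ofReal_re]

lemma summable_dualGaussian (z : ℍ) {t : ℝ} (ht : 0 < t) : Summable (dualGaussian z t) := by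
  have hy := z.im_pos
  obtain ⟨c, hc, h1, h2⟩ : ∃ c : ℝ, 0 < c ∧ c ≤ z.im / t ∧ c ≤ t * z.im :=
    ⟨min (z.im / t) (t * z.im), lt_min (by positivity) (by positivity), min_le_left _ _,
      min_le_right _ _⟩
  have hs := summable_exp_neg_sqLength (mul_pos Real.pi_pos hc)
  have hle : ∀ p : Lattice, ‖dualGaussian z t p.1‖ ≤ Real.exp (-(Real.pi * c) * sqLength p) := by
    intro p
    rw [norm_dualGaussian, Real.exp_le_exp]
    have h4 := mul_le_mul_of_nonneg_right h1 (sq_nonneg (p.1.2 : ℝ))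
    have h5 := mul_le_mul_of_nonneg_right h2 (sq_nonneg (p.1.1 : ℝ))
    have h6 := mul_le_mul_of_nonneg_left (add_le_add h4 h5) Real.pi_pos.le
    rw [sqLength]
    linarith
  exact summable_of_summable_lattice (hs.of_norm_bounded hle)

/-- The Gaussian `exp (-π t |m z + n|² / y)` on the lattice `ℤ z + ℤ`. -/
noncomputable def latticeGaussian (z : ℍ) (t : ℝ) (p : ℤ × ℤ) : ℂ :=
  Complex.exp (-Real.pi * t * (((p.1 : ℂ) * z.re + p.2) ^ 2 + (p.1 : ℂ) ^ 2 * (z.im : ℂ) ^ 2) /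
    z.im)

lemma latticeGaussian_eq (z : ℍ) (t : ℝ) (p : Lattice) :
    latticeGaussian z t p.1 = Real.exp (thetaForm (p, t) (gram z)) • (1 : ℂ) := by
  have hy : (z.im : ℂ) ≠ 0 := by exact_mod_cast z.im_ne_zero
  rw [latticeGaussian, Complex.real_smul, mul_one, Complex.ofReal_exp]
  congr 1
  simp only [thetaForm_apply, quadForm_apply, gram, UpperHalfPlane.coe_re, UpperHalfPlane.coe_im]
  push_cast
  field_simp
  ring

lemma summable_latticeGaussian (z : ℍ) {t : ℝ} (ht : 0 < t) : Summable (latticeGaussian z t) := by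
  refine summable_of_summable_lattice ?_
  simp only [latticeGaussian_eq]
  exact ((isSubexponential_const 1).hasSum z ht).summable

lemma tsum_latticeGaussian (z : ℍ) {t : ℝ} (ht : 0 < t) :
    ∑' p, latticeGaussian z t p = 1 + thetaSeries (fun _ => 1) z t := by
  rw [tsum_eq_add_tsum_lattice (summable_latticeGaussian z ht), thetaSeries]
  simp only [latticeGaussian_eq]
  simp [latticeGaussian]

/-- Poisson summation in `n` with `m` fixed: `Complex.tsum_exp_neg_quadratic` with `a = y/t` and `b
= -i m x`, so that `i b = m x` is the shift. -/
lemma tsum_latticeGaussian_right (z : ℍ) {t : ℝ} (ht : 0 < t) (m : ℤ) :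
    ∑' n : ℤ, latticeGaussian z t (m, n) =
      ((z.im / t : ℝ) : ℂ) ^ (1 / 2 : ℂ) * ∑' n : ℤ, dualGaussian z t (m, n) := by
  have hy : (z.im : ℂ) ≠ 0 := by exact_mod_cast z.im_ne_zero
  have htC : (t : ℂ) ≠ 0 := by exact_mod_cast ht.ne'
  have ha : 0 < z.im / t := div_pos z.im_pos ht
  have haC : (((z.im / t : ℝ) : ℂ)) ^ (1 / 2 : ℂ) ≠ 0 := by
    rw [Ne, Complex.cpow_eq_zero_iff, not_and_or]
    exact Or.inl (by exact_mod_cast ha.ne')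
  have h := Complex.tsum_exp_neg_quadratic (a := ((z.im / t : ℝ) : ℂ)) (by simpa using ha)
    (-Complex.I * m * z.re)
  have h1 : ∀ n : ℤ, latticeGaussian z t (m, n) =
      Complex.exp (-Real.pi * (t * z.im : ℝ) * m ^ 2) *
      Complex.exp (-Real.pi / ((z.im / t : ℝ) : ℂ) *
        (n + Complex.I * (-Complex.I * m * z.re)) ^ 2) := by
    intro n
    rw [latticeGaussian, ← Complex.exp_add]
    congr 1
    have : Complex.I * (-Complex.I * m * z.re) = m * z.re := by
      linear_combination (-(m : ℂ) * z.re) * Complex.I_mul_I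
    rw [this]
    push_cast
    field_simp
    ring
  have h2 : ∀ n : ℤ, dualGaussian z t (m, n) =
      Complex.exp (-Real.pi * (t * z.im : ℝ) * m ^ 2) *
      Complex.exp (-Real.pi * ((z.im / t : ℝ) : ℂ) * n ^ 2 +
        2 * Real.pi * (-Complex.I * m * z.re) * n) := by
    intro n
    rw [dualGaussian, ← Complex.exp_add]
    congr 1
    ring
  simp only [h1, h2, tsum_mul_left, h]
  field_simp

/-- The transformation formula of the theta series of the lattice `ℤ z + ℤ`. -/
theorem thetaSeries_one_inv (z : ℍ) {t : ℝ} (ht : 0 < t) :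
    1 + thetaSeries (fun _ => 1) z t⁻¹ = t * (1 + thetaSeries (fun _ => 1) z t) := by
  have ht' : 0 < t⁻¹ := inv_pos.2 ht
  have hy := z.im_pos
  have hkey : ∀ {t : ℝ}, 0 < t → 1 + thetaSeries (fun _ => 1) z t =
      ((z.im / t : ℝ) : ℂ) ^ (1 / 2 : ℂ) * ∑' p, dualGaussian z t p := by
    intro t ht
    rw [← tsum_latticeGaussian z ht, (summable_latticeGaussian z ht).tsum_prod,
      (summable_dualGaussian z ht).tsum_prod]
    simp only [tsum_latticeGaussian_right z ht, tsum_mul_left]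
  rw [hkey ht', hkey ht]
  simp only [dualGaussian_inv]
  rw [← (Equiv.prodComm ℤ ℤ).tsum_eq (dualGaussian z t), ← mul_assoc]
  congr 1
  have h1 : ∀ x : ℝ, 0 < x → ((x : ℝ) : ℂ) ^ (1 / 2 : ℂ) = ((√x : ℝ) : ℂ) := by
    intro x hx
    rw [Real.sqrt_eq_rpow, Complex.ofReal_cpow hx.le]
    norm_num
  -- What remains is `√(y t) = t √(y/t)`.
  rw [h1 _ (by positivity), h1 _ (by positivity)]
  norm_cast
  rw [Real.sqrt_eq_iff_mul_self_eq (by positivity) (by positivity)]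
  have := Real.mul_self_sqrt (show 0 ≤ z.im / t by positivity)
  rw [mul_mul_mul_comm, this]
  field_simp

lemma isAdmissible_dirac {t : ℝ} (ht : 0 < t) : IsAdmissible (Measure.dirac t) fun _ => 1 :=
  ⟨⟨t, ht, by simp [ae_dirac_eq]⟩, aestronglyMeasurable_const, fun δ _ => integrable_dirac (by simp)⟩

/-- A point mass makes a single theta series a theta integral, so the formulas for `ξ₀` and `Δ₀`
apply at fixed `t`. -/
lemma thetaIntegral_dirac (t : ℝ) (κ : Lattice × ℝ → ℂ) (z : ℍ) :
    thetaIntegral (Measure.dirac t) (fun _ => 1) κ z = thetaSeries κ z t := by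
  simp [thetaIntegral]

lemma thetaIntegral_dirac_inv {t : ℝ} (ht : 0 < t) :
    thetaIntegral (Measure.dirac t⁻¹) (fun _ => 1) (fun _ => 1) = fun z =>
      (t : ℂ) * thetaIntegral (Measure.dirac t) (fun _ => 1) (fun _ => 1) z + (t - 1) := by
  funext z
  rw [thetaIntegral_dirac, thetaIntegral_dirac]
  linear_combination thetaSeries_one_inv z ht

/-- Apply `ξ₀` to the transformation law in `z`: the constant `t - 1` dies and the real factor `t`
comes out. The law for `laplacianCoeff` arises in the same way from `Δ₀`. -/
theorem thetaSeries_xiCoeff_inv (z : ℍ) {t : ℝ} (ht : 0 < t) :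
    thetaSeries (xiCoeff z) z t⁻¹ = t * thetaSeries (xiCoeff z) z t := by
  have h := isAdmissible_dirac ht
  have h' := isAdmissible_dirac (inv_pos.2 ht)
  rw [← thetaIntegral_dirac, ← thetaIntegral_dirac, ← h.xi_thetaIntegral, ← h'.xi_thetaIntegral,
    thetaIntegral_dirac_inv ht, xi_affine (h.isSmooth_thetaIntegral (isSubexponential_const 1))]

theorem thetaSeries_laplacianCoeff_inv (z : ℍ) {t : ℝ} (ht : 0 < t) :
    thetaSeries (laplacianCoeff z) z t⁻¹ = t * thetaSeries (laplacianCoeff z) z t := by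
  have h := isAdmissible_dirac ht
  have h' := isAdmissible_dirac (inv_pos.2 ht)
  rw [← thetaIntegral_dirac, ← thetaIntegral_dirac, ← h.laplacian_thetaIntegral,
    ← h'.laplacian_thetaIntegral, thetaIntegral_dirac_inv ht,
    laplacian_affine (h.isSmooth_thetaIntegral (isSubexponential_const 1))]

end FunctionalEquation

/-! ### Symmetrized Mellin transforms and analytic continuation -/

section Mellin

open MeasureTheory Filter Topology Asymptotics Set

/-- Functions on the positive half-line that are negligible at `0` and at `∞`, so that their
Mellin transform is entire. -/
structure IsFlat (f : ℝ → ℂ) : Prop where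
  locallyIntegrableOn : LocallyIntegrableOn f (Ioi 0)
  top : ∀ a : ℝ, f =O[atTop] fun t => t ^ (-a)
  bot : ∀ b : ℝ, f =O[𝓝[>] 0] fun t => t ^ (-b)

namespace IsFlat

lemma log_smul {f : ℝ → ℂ} (hf : IsFlat f) : IsFlat fun t => Real.log t • f t :=
  ⟨hf.locallyIntegrableOn.continuousOn_smul isOpen_Ioi.isLocallyClosed
      (Real.continuousOn_log.mono fun _ ht => ne_of_gt ht),
    fun a => isBigO_rpow_top_log_smul (lt_add_one a) (hf.top _),
    fun b => isBigO_rpow_zero_log_smul (sub_one_lt b) (hf.bot _)⟩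

lemma mellinConvergent {f : ℝ → ℂ} (hf : IsFlat f) (s : ℂ) : MellinConvergent f s :=
  mellinConvergent_of_isBigO_rpow hf.locallyIntegrableOn (hf.top _) (lt_add_one _) (hf.bot _)
    (sub_one_lt _)

lemma hasDerivAt_mellin {f : ℝ → ℂ} (hf : IsFlat f) (s : ℂ) :
    HasDerivAt (mellin f) (mellin (fun t => Real.log t • f t) s) s :=
  (mellin_hasDerivAt_of_isBigO_rpow hf.locallyIntegrableOn (hf.top _) (lt_add_one _) (hf.bot _)
    (sub_one_lt _)).2

lemma differentiable_mellin {f : ℝ → ℂ} (hf : IsFlat f) : Differentiable ℂ (mellin f) :=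
  fun s => (hf.hasDerivAt_mellin s).differentiableAt

lemma log_pow_smul {f : ℝ → ℂ} (hf : IsFlat f) (n : ℕ) : IsFlat fun t => Real.log t ^ n • f t := by
  induction n with
  | zero => simpa using hf
  | succ n ih => simpa only [pow_succ', mul_smul] using ih.log_smul

lemma iteratedDeriv_mellin {f : ℝ → ℂ} (hf : IsFlat f) (n : ℕ) :
    iteratedDeriv n (mellin f) = mellin fun t => Real.log t ^ n • f t := by
  induction n with
  | zero => simp
  | succ n ih =>
    funext s
    rw [iteratedDeriv_succ, ih, ((hf.log_pow_smul n).hasDerivAt_mellin s).deriv]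
    simp only [pow_succ', mul_smul]

end IsFlat

/-- The restriction of `g` to `t > 1`. -/
noncomputable def tail (g : ℝ → ℂ) : ℝ → ℂ := indicator (Ioi 1) g

/-- Integrable functions with exponential decay on `t > 1`. -/
structure DecaysExponentially (g : ℝ → ℂ) : Prop where
  integrableOn : IntegrableOn g (Ioi 1)
  bound : ∃ C δ : ℝ, 0 < δ ∧ ∀ t : ℝ, 1 ≤ t → ‖g t‖ ≤ C * Real.exp (-δ * t)

lemma DecaysExponentially.isFlat_tail {g : ℝ → ℂ} (hg : DecaysExponentially g) :
    IsFlat (tail g) := by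
  refine ⟨?_, fun a => ?_, fun b => ?_⟩
  · exact ((integrable_indicator_iff measurableSet_Ioi).2 hg.integrableOn).locallyIntegrable
      |>.locallyIntegrableOn _
  · obtain ⟨C, δ, hδ, h⟩ := hg.bound
    refine IsBigO.trans (IsBigO.of_bound C ?_) (isLittleO_exp_neg_mul_rpow_atTop hδ (-a)).isBigO
    filter_upwards [eventually_gt_atTop 1] with t ht
    rw [tail, indicator_of_mem (mem_Ioi.2 ht), Real.norm_of_nonneg (Real.exp_pos _).le]
    exact h t ht.le
  · refine (isBigO_zero _ _).congr' ?_ EventuallyEq.rfl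
    have : Ioo (0 : ℝ) 1 ∈ 𝓝[>] (0 : ℝ) := Ioo_mem_nhdsGT one_pos
    filter_upwards [this] with t ht
    rw [tail, indicator_of_notMem (by simpa using ht.2.le)]

/-- The symmetrized Mellin transform `∫_{t > 1} g(t) (t^s + t^{1-s}) dt/t`. -/
noncomputable def symMellin (g : ℝ → ℂ) (s : ℂ) : ℂ := mellin (tail g) s + mellin (tail g) (1 - s)

lemma symMellin_one_sub (g : ℝ → ℂ) (s : ℂ) : symMellin g (1 - s) = symMellin g s := by
  rw [symMellin, symMellin, sub_sub_cancel, add_comm]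

lemma DecaysExponentially.differentiable_symMellin {g : ℝ → ℂ} (hg : DecaysExponentially g) :
    Differentiable ℂ (symMellin g) :=
  hg.isFlat_tail.differentiable_mellin.add
    (hg.isFlat_tail.differentiable_mellin.comp (differentiable_id.const_sub 1))

/-- Differentiating `t^s` and `t^{1-s}` at `s = 0` gives `(log t)^n` and `(-log t)^n t`; the measure
`dt/t` accounts for the inverse. -/
lemma DecaysExponentially.iteratedDeriv_symMellin {g : ℝ → ℂ} (hg : DecaysExponentially g) (n : ℕ) :
    iteratedDeriv n (symMellin g) 0 =
      ∫ t in Ioi (1 : ℝ), g t * ((Real.log t ^ n * (t⁻¹ + (-1) ^ n) : ℝ) : ℂ) := by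
  have hf := hg.isFlat_tail
  have hcd : ∀ m : WithTop ℕ∞, ContDiff ℂ m (mellin (tail g)) := fun m =>
    hf.differentiable_mellin.contDiff
  have h1 : iteratedDeriv n (symMellin g) 0 = mellin (fun t => Real.log t ^ n • tail g t) 0 +
      (-1) ^ n * mellin (fun t => Real.log t ^ n • tail g t) 1 := by
    have hadd : symMellin g = mellin (tail g) + fun s => mellin (tail g) (1 - s) := rfl
    have hcd' : ContDiff ℂ n fun s => mellin (tail g) (1 - s) :=
      (hcd n).comp (contDiff_const.sub contDiff_id)
    rw [hadd, iteratedDeriv_add (hcd n).contDiffAt hcd'.contDiffAt, iteratedDeriv_comp_const_sub,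
      hf.iteratedDeriv_mellin]
    simp
  have hc := hf.log_pow_smul n
  have h2 : ∀ s, mellin (fun t => Real.log t ^ n • tail g t) s =
      ∫ t in Ioi (1 : ℝ), (t : ℂ) ^ (s - 1) • (Real.log t ^ n • g t) := by
    intro s
    rw [mellin]
    have : (fun t : ℝ => (t : ℂ) ^ (s - 1) • (Real.log t ^ n • tail g t)) =
        indicator (Ioi 1) fun t : ℝ => (t : ℂ) ^ (s - 1) • (Real.log t ^ n • g t) := by
      funext t
      by_cases ht : t ∈ Ioi (1 : ℝ) <;> simp [tail, ht]
    rw [this, setIntegral_indicator measurableSet_Ioi, Ioi_inter_Ioi]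
    simp
  have h3 : ∀ s : ℂ, IntegrableOn (fun t : ℝ => (t : ℂ) ^ (s - 1) • (Real.log t ^ n • g t))
      (Ioi 1) := by
    intro s
    refine ((hc.mellinConvergent s).mono_set (Ioi_subset_Ioi zero_le_one)).congr_fun ?_
      measurableSet_Ioi
    intro t ht
    simp [tail, ht]
  rw [h1, h2, h2, ← integral_const_mul, ← integral_add (h3 0) ((h3 1).const_mul _)]
  refine setIntegral_congr_fun measurableSet_Ioi fun t _ => ?_
  simp [Complex.cpow_neg_one]
  ring

/-- The Mellin transform of a function `g` for which `g + g₀` satisfies the functional equation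
of a theta series of weight `1`. -/
lemma DecaysExponentially.hasMellin {g : ℝ → ℂ} (hg : DecaysExponentially g) {g₀ : ℂ}
    (hfe : ∀ t : ℝ, 0 < t → g t⁻¹ + g₀ = t * (g t + g₀)) {s : ℂ} (hs : 1 < s.re) :
    mellin g s = symMellin g s + g₀ / (s * (s - 1)) := by
  have hf := hg.isFlat_tail
  have hs0 : s ≠ 0 := fun h => by rw [h] at hs; norm_num at hs
  have hs1 : s - 1 ≠ 0 := fun h => by
    rw [sub_eq_zero.1 h] at hs; norm_num at hs
  have e1 : HasMellin (tail g) s (mellin (tail g) s) := ⟨hf.mellinConvergent s, rfl⟩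
  have e2 : HasMellin (fun t : ℝ => (t : ℂ) ^ (-1 : ℂ) • tail g t⁻¹) s
      (mellin (tail g) (1 - s)) := by
    refine ⟨?_, ?_⟩
    · rw [MellinConvergent.cpow_smul]
      have := MellinConvergent.comp_rpow (f := tail g) (s := s + -1) (a := -1) (by norm_num)
      simp only [Real.rpow_neg_one] at this
      exact this.2 (hf.mellinConvergent _)
    · rw [mellin_cpow_smul, mellin_comp_inv]
      congr 1; ring
  -- On `(0,1)` the functional equation reads `g(t) = t⁻¹ g(t⁻¹) + g₀ (t⁻¹ - 1)`. The pieces `e3`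
  -- and `e4` transform the last bracket into `1/(s-1) - 1/s`.
  have e3 := hasMellin_one_Ioc (s := s) (by linarith)
  have e4 := hasMellin_cpow_Ioc (-1) (s := s) (by simp; linarith)
  have e5 := hasMellin_sub e4.1 e3.1
  rw [e3.2, e4.2] at e5
  have e6 := hasMellin_const_smul e5.1 g₀
  rw [e5.2] at e6
  have e7 := hasMellin_add e1.1 e2.1
  rw [e2.2] at e7
  have e8 := hasMellin_add e7.1 e6.1
  rw [e7.2, e6.2] at e8
  have hval : g₀ • (1 / (s + -1) - 1 / s) = g₀ / (s * (s - 1)) := by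
    rw [smul_eq_mul, ← sub_eq_add_neg]; field_simp; ring
  rw [hval] at e8
  rw [symMellin, ← e8.2, mellin, mellin]
  refine setIntegral_congr_ae measurableSet_Ioi ?_
  -- At `t = 1` both tails vanish, so the decomposition is only claimed off this null set.
  have hne : ∀ᵐ t : ℝ, t ≠ 1 := by simp [ae_iff, measure_singleton]
  filter_upwards [hne] with t ht1 ht0
  congr 1
  have ht0' : (0 : ℝ) < t := ht0
  have htC : (t : ℂ) ≠ 0 := by exact_mod_cast ht0'.ne'
  have hfet := hfe t ht0'
  rcases lt_or_gt_of_ne ht1 with h | h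
  · have hinv : 1 < t⁻¹ := (one_lt_inv₀ ht0').2 h
    simp only [tail]
    rw [indicator_of_notMem (by simpa using h.le), indicator_of_mem (mem_Ioi.2 hinv),
      indicator_of_mem (mem_Ioc.2 ⟨ht0', h.le⟩), indicator_of_mem (mem_Ioc.2 ⟨ht0', h.le⟩),
      Complex.cpow_neg_one]
    simp only [smul_eq_mul]
    generalize g t⁻¹ = A at hfet ⊢
    field_simp
    linear_combination -hfet
  · have hinv : t⁻¹ ≤ 1 := (inv_lt_one_of_one_lt₀ h).le
    simp only [tail]
    rw [indicator_of_mem (mem_Ioi.2 h), indicator_of_notMem (by simpa using hinv),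
      indicator_of_notMem (by simp [h]), indicator_of_notMem (by simp [h])]
    simp

/-- The Mellin transform of a sum of dilates of `f`. -/
lemma mellin_tsum_dilate {ι : Type*} [Countable ι] {f g : ℝ → ℂ} {s : ℂ} (hf : MellinConvergent f s)
    {a : ι → ℂ} {q : ι → ℝ} (hq : ∀ i, 0 < q i) (hs : Summable fun i => ‖a i‖ * q i ^ (-s.re))
    (hg : ∀ t : ℝ, 0 < t → g t = ∑' i, a i * f (q i * t)) :
    mellin g s = mellin f s * ∑' i, a i * (q i : ℂ) ^ (-s) := by
  have h1 : ∀ i, IntegrableOn (fun t : ℝ => (t : ℂ) ^ (s - 1) • (a i * f (q i * t))) (Ioi 0) := by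
    intro i
    have := ((MellinConvergent.comp_mul_left (hq i)).2 hf).const_smul (a i)
    exact this
  have h2 : ∀ i, ∫ t in Ioi (0 : ℝ), (t : ℂ) ^ (s - 1) • (a i * f (q i * t)) =
      mellin f s * (a i * (q i : ℂ) ^ (-s)) := by
    intro i
    have e1 := mellin_const_smul (fun t => f (q i * t)) s (a i)
    rw [mellin_comp_mul_left f s (hq i)] at e1
    simp only [mellin, smul_eq_mul] at e1 ⊢
    rw [e1]; ring
  have h3 : ∀ i, ∫ t in Ioi (0 : ℝ), ‖(t : ℂ) ^ (s - 1) • (a i * f (q i * t))‖ =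
      ‖a i‖ * q i ^ (-s.re) * ∫ t in Ioi (0 : ℝ), t ^ (s.re - 1) * ‖f t‖ := by
    intro i
    -- The integral of norms is itself a Mellin transform, of `‖f‖` at the real point `s.re`, so the
    -- dilation rule also gives the summability bound.
    have e1 := mellin_comp_mul_left (fun t => ((‖f t‖ : ℝ) : ℂ)) (s.re : ℂ) (hq i)
    have e2 : ∀ F : ℝ → ℂ, mellin (fun t => ((‖F t‖ : ℝ) : ℂ)) (s.re : ℂ) =
        ((∫ t in Ioi (0 : ℝ), t ^ (s.re - 1) * ‖F t‖ : ℝ) : ℂ) := by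
      intro F
      rw [mellin, ← integral_complex_ofReal]
      refine setIntegral_congr_fun measurableSet_Ioi fun t ht => ?_
      simp only [smul_eq_mul]
      push_cast
      rw [Complex.ofReal_cpow (le_of_lt ht)]
      push_cast
      ring
    rw [e2 f, e2 fun t => f (q i * t)] at e1
    rw [show -(s.re : ℂ) = ((-s.re : ℝ) : ℂ) by push_cast; ring,
      ← Complex.ofReal_cpow (hq i).le, smul_eq_mul] at e1
    have e3 : ∫ t in Ioi (0 : ℝ), t ^ (s.re - 1) * ‖f (q i * t)‖ =
        q i ^ (-s.re) * ∫ t in Ioi (0 : ℝ), t ^ (s.re - 1) * ‖f t‖ := by exact_mod_cast e1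
    rw [mul_assoc, ← e3, ← integral_const_mul]
    refine setIntegral_congr_fun measurableSet_Ioi fun t ht => ?_
    simp only [norm_smul, norm_mul, Complex.norm_cpow_eq_rpow_re_of_pos (mem_Ioi.1 ht)]
    simp
    ring
  have h4 := hasSum_integral_of_summable_integral_norm h1
    (by simpa only [h3] using hs.mul_right _)
  simp only [h2] at h4
  rw [← tsum_mul_left, h4.tsum_eq, mellin]
  refine setIntegral_congr_fun measurableSet_Ioi fun t ht => ?_
  simp only [hg t ht, smul_eq_mul, tsum_mul_left]

end Mellin

/-! ### Taylor coefficients as theta integrals, and Dirichlet series of the theta series -/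

section Completed

open MeasureTheory Filter Topology Asymptotics Set

lemma isAdmissible_of_le_pow {w : ℝ → ℝ} (hw : ContinuousOn w (Ici 1)) {C : ℝ} {n : ℕ}
    (hC : ∀ t : ℝ, 1 ≤ t → |w t| ≤ C * t ^ n) : IsAdmissible (volume.restrict (Ioi 1)) w := by
  refine ⟨⟨1, one_pos, (ae_restrict_mem measurableSet_Ioi).mono fun t ht => le_of_lt ht⟩,
    (hw.mono Ioi_subset_Ici_self).aestronglyMeasurable measurableSet_Ioi, fun δ hδ => ?_⟩
  refine integrable_of_isBigO_exp_neg (b := δ / 2) (by positivity) ?_ ?_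
  · exact (by fun_prop : Continuous fun t : ℝ => Real.exp (-δ * t)).continuousOn.mul hw.norm
  · have h1 : (fun t : ℝ => Real.exp (-δ * t) * ‖w t‖) =O[atTop]
        fun t => Real.exp (-δ * t) * t ^ n := by
      refine IsBigO.of_bound C ?_
      filter_upwards [eventually_ge_atTop 1] with t ht
      have ht0 : 0 ≤ t := zero_le_one.trans ht
      rw [norm_mul, norm_norm, norm_mul, Real.norm_of_nonneg (Real.exp_pos _).le,
        Real.norm_of_nonneg (by positivity : 0 ≤ t ^ n)]
      calc _ ≤ Real.exp (-δ * t) * (C * t ^ n) := by gcongr; exact hC t ht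
        _ = _ := by ring
    have h2 : (fun t : ℝ => t ^ n) =O[atTop] fun t => Real.exp (δ / 2 * t) :=
      (isLittleO_pow_exp_pos_mul_atTop (k := n) (b := δ / 2) (by positivity)).isBigO
    refine h1.trans (((isBigO_refl (fun t : ℝ => Real.exp (-δ * t)) atTop).mul h2).congr_right ?_)
    intro t
    rw [← Real.exp_add]; ring_nf

/-- The weights `(log t)ⁿ (t⁻¹ + (-1)ⁿ)` that compute the derivatives at `0` of the symmetrized
Mellin transform. -/
noncomputable def logWeight (n : ℕ) (t : ℝ) : ℝ := Real.log t ^ n * (t⁻¹ + (-1) ^ n)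

lemma isAdmissible_logWeight (n : ℕ) : IsAdmissible (volume.restrict (Ioi 1)) (logWeight n) := by
  refine isAdmissible_of_le_pow (C := 2) (n := n) ?_ fun t ht => ?_
  · have hne : ∀ t ∈ Ici (1 : ℝ), t ≠ 0 := fun t ht => (zero_lt_one.trans_le ht).ne'
    exact ((continuousOn_id.log hne).pow n).mul ((continuousOn_id.inv₀ hne).add continuousOn_const)
  · have h1 : 0 ≤ Real.log t := Real.log_nonneg ht
    have h2 : Real.log t ≤ t := (Real.log_le_sub_one_of_pos (by linarith)).trans (by linarith)
    have h3 : |t⁻¹ + (-1) ^ n| ≤ 2 := by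
      refine (abs_add_le _ _).trans ?_
      rw [abs_pow, abs_neg, abs_one, one_pow, abs_of_pos (by positivity)]
      linarith [inv_le_one_of_one_le₀ ht]
    rw [logWeight, abs_mul, abs_pow, abs_of_nonneg h1, mul_comm]
    gcongr

lemma IsSubexponential.decaysExponentially {κ : Lattice × ℝ → ℂ} (hκ : IsSubexponential κ) (z : ℍ) :
    DecaysExponentially (thetaSeries κ z) := by
  refine ⟨?_, hκ.exists_norm_thetaSeries_le z⟩
  have h : IsAdmissible (volume.restrict (Ioi 1)) fun _ => 1 :=
    isAdmissible_of_le_pow (C := 1) (n := 0) continuousOn_const fun t _ => by simp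
  have h1 := (h.integral_thetaSeries hκ z).1
  simp only [Complex.ofReal_one, mul_one] at h1
  exact h1

/-- The coefficient of `sⁿ` in the Taylor expansion at `0` of an entire function. -/
noncomputable def taylorAt (n : ℕ) (f : ℂ → ℂ) : ℂ := iteratedDeriv n f 0 / (n ! : ℂ)

/-- The Taylor coefficients at `0` of the symmetrized Mellin transform of a theta series. -/
noncomputable def mellinCoeff (κ : Lattice × ℝ → ℂ) (n : ℕ) (z : ℍ) : ℂ :=
  taylorAt n (symMellin (thetaSeries κ z))

/-- Turns a Taylor coefficient in `s` into a theta integral, to which the operators in `z` apply.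
The trailing `+ 0` fits the shape of `xi_affine` and `laplacian_affine`. -/
lemma mellinCoeff_eq {κ : Lattice × ℝ → ℂ} (n : ℕ) (z : ℍ) (hκ : IsSubexponential κ) :
    mellinCoeff κ n z = (((n ! : ℝ)⁻¹ : ℝ) : ℂ) *
      thetaIntegral (volume.restrict (Ioi 1)) (logWeight n) κ z + 0 := by
  rw [mellinCoeff, taylorAt, (hκ.decaysExponentially z).iteratedDeriv_symMellin, thetaIntegral]
  push_cast
  rw [div_eq_inv_mul, add_zero]
  simp [logWeight]

lemma mellinCoeff_one_eq (n : ℕ) : mellinCoeff (fun _ => 1) n = fun z =>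
    (((n ! : ℝ)⁻¹ : ℝ) : ℂ) *
      thetaIntegral (volume.restrict (Ioi 1)) (logWeight n) (fun _ => 1) z + 0 :=
  funext fun z => mellinCoeff_eq n z (isSubexponential_const 1)

lemma isSmooth_mellinCoeff (n : ℕ) : IsSmooth (mellinCoeff (fun _ => 1) n) := by
  rw [mellinCoeff_one_eq]
  exact (((isAdmissible_logWeight n).isSmooth_thetaIntegral
    (isSubexponential_const 1)).const_mul _).add (isSmooth_const 0)

lemma xi_mellinCoeff (n : ℕ) (z : ℍ) :
    xi 0 (mellinCoeff (fun _ => 1) n) z = mellinCoeff (xiCoeff z) n z := by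
  have h := isAdmissible_logWeight n
  rw [mellinCoeff_one_eq, xi_affine (h.isSmooth_thetaIntegral (isSubexponential_const 1)),
    h.xi_thetaIntegral, mellinCoeff_eq n z (isSubexponential_xiCoeff z), add_zero]

lemma laplacian_mellinCoeff (n : ℕ) (z : ℍ) :
    laplacian 0 (mellinCoeff (fun _ => 1) n) z = mellinCoeff (laplacianCoeff z) n z := by
  have h := isAdmissible_logWeight n
  rw [mellinCoeff_one_eq, laplacian_affine (h.isSmooth_thetaIntegral (isSubexponential_const 1)),
    h.laplacian_thetaIntegral, mellinCoeff_eq n z (isSubexponential_laplacianCoeff z), add_zero]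

/-! ### Mellin transforms of theta series -/

lemma quadForm_gram_pos (z : ℍ) (p : Lattice) : 0 < quadForm p (gram z) := by
  obtain ⟨ε, hε, h⟩ := gram_mem_posForms z
  exact (mul_pos hε (zero_lt_one.trans_le (one_le_sqLength p))).trans_le (h p)

lemma summable_quadForm_rpow (z : ℍ) {σ : ℝ} (hσ : 1 < σ) :
    Summable fun p : Lattice => quadForm p (gram z) ^ (-σ) := by
  obtain ⟨ε, hε, h⟩ := gram_mem_posForms z
  refine ((summable_sqLength_rpow hσ).mul_left (ε ^ (-σ))).of_nonneg_of_le
    (fun p => Real.rpow_nonneg (quadForm_gram_pos z p).le _) fun p => ?_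
  have h1 := one_le_sqLength p
  rw [← Real.mul_rpow hε.le (by linarith)]
  exact Real.rpow_le_rpow_of_nonpos (by positivity) (h p) (by linarith)

lemma hasMellin_exp_neg_pi {s : ℂ} (hs : 0 < s.re) :
    HasMellin (fun t : ℝ => ((Real.exp (-(Real.pi * t)) : ℝ) : ℂ)) s
      ((Real.pi : ℂ) ^ (-s) * Complex.Gamma s) := by
  have h : MellinConvergent (fun t : ℝ => ((Real.exp (-t) : ℝ) : ℂ)) s := by
    simpa only [MellinConvergent, smul_eq_mul, mul_comm] using Complex.GammaIntegral_convergent hs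
  refine ⟨(MellinConvergent.comp_mul_left
    (f := fun t : ℝ => ((Real.exp (-t) : ℝ) : ℂ)) Real.pi_pos).2 h, ?_⟩
  rw [mellin_comp_mul_left (fun t : ℝ => ((Real.exp (-t) : ℝ) : ℂ)) s Real.pi_pos,
    Complex.Gamma_eq_integral hs, Complex.GammaIntegral_eq_mellin, smul_eq_mul]

/-- The factor `t^n` shifts `s` by `n`, and `π^n` compensates the shift in `π^{-s}`. -/
lemma hasMellin_pow_mul_exp_neg_pi {s : ℂ} (hs : 0 < s.re) (n : ℕ) :
    HasMellin (fun t : ℝ => ((Real.pi * t : ℝ) : ℂ) ^ n *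
      ((Real.exp (-(Real.pi * t)) : ℝ) : ℂ)) s
      ((Real.pi : ℂ) ^ (-s) * Complex.Gamma (s + n)) := by
  have hpi : (Real.pi : ℂ) ≠ 0 := by exact_mod_cast Real.pi_ne_zero
  have h := hasMellin_exp_neg_pi (s := s + n) (by simp; positivity)
  have h1 := MellinConvergent.cpow_smul.2 h.1
  have h2 := hasMellin_const_smul h1 ((Real.pi : ℂ) ^ n)
  rw [mellin_cpow_smul, h.2] at h2
  have he : (fun t : ℝ => ((Real.pi * t : ℝ) : ℂ) ^ n * ((Real.exp (-(Real.pi * t)) : ℝ) : ℂ)) =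
      fun t : ℝ => (Real.pi : ℂ) ^ n • ((t : ℂ) ^ (n : ℂ) •
        ((Real.exp (-(Real.pi * t)) : ℝ) : ℂ)) := by
    funext t
    simp only [smul_eq_mul, Complex.cpow_natCast]
    push_cast
    ring
  rw [he]
  convert h2 using 1
  rw [neg_add, Complex.cpow_add _ _ hpi, Complex.cpow_neg _ (n : ℂ), Complex.cpow_natCast,
    smul_eq_mul]
  field_simp

lemma exp_thetaForm (p : Lattice) (t : ℝ) (z : ℍ) : Real.exp (thetaForm (p, t) (gram z)) =
    Real.exp (-(Real.pi * (quadForm p (gram z) * t))) := by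
  rw [thetaForm_apply]; ring_nf

/-- The Epstein zeta function of the quadratic form attached to `z`. -/
noncomputable def epstein (z : ℍ) (s : ℂ) : ℂ :=
  ∑' p : Lattice, ((quadForm p (gram z) : ℝ) : ℂ) ^ (-s)

lemma mellin_thetaSeries_one (z : ℍ) {s : ℂ} (hs : 1 < s.re) :
    mellin (thetaSeries (fun _ => 1) z) s =
      (Real.pi : ℂ) ^ (-s) * Complex.Gamma s * epstein z s := by
  have h := hasMellin_exp_neg_pi (s := s) (by linarith)
  rw [mellin_tsum_dilate (a := fun _ : Lattice => 1) h.1 (quadForm_gram_pos z)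
    (by simpa using summable_quadForm_rpow z hs) fun t _ => ?_, h.2, epstein]
  · simp
  · simp only [thetaSeries, exp_thetaForm]
    exact tsum_congr fun p => by rw [Complex.real_smul]; ring

/-- With `u = πtQ` the coefficient is `u² - 2u`, and `Γ(s+2) - 2Γ(s+1) = s(s-1)Γ(s)` produces the
eigenvalue. -/
lemma mellin_thetaSeries_laplacianCoeff (z : ℍ) {s : ℂ} (hs : 1 < s.re) :
    mellin (thetaSeries (laplacianCoeff z) z) s =
      s * (s - 1) * ((Real.pi : ℂ) ^ (-s) * Complex.Gamma s * epstein z s) := by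
  have hs0 : s ≠ 0 := fun h => by rw [h] at hs; norm_num at hs
  have hs1 : s + 1 ≠ 0 := fun h => by
    rw [eq_neg_of_add_eq_zero_left h] at hs; norm_num at hs
  have h1 := hasMellin_pow_mul_exp_neg_pi (s := s) (by linarith) 1
  have h2 := hasMellin_pow_mul_exp_neg_pi (s := s) (by linarith) 2
  have h3 := hasMellin_const_smul h1.1 (2 : ℂ)
  have h4 := hasMellin_sub h2.1 h3.1
  rw [h3.2, h2.2, h1.2] at h4
  rw [mellin_tsum_dilate (a := fun _ : Lattice => 1) h4.1 (quadForm_gram_pos z)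
    (by simpa using summable_quadForm_rpow z hs) fun t _ => ?_, h4.2]
  · have g1 : Complex.Gamma (s + (1 : ℕ)) = s * Complex.Gamma s := by
      rw [Nat.cast_one, Complex.Gamma_add_one s hs0]
    have g2 : Complex.Gamma (s + (2 : ℕ)) = (s + 1) * (s * Complex.Gamma s) := by
      rw [← Complex.Gamma_add_one s hs0, ← Complex.Gamma_add_one (s + 1) hs1]
      congr 1; push_cast; ring
    rw [g1, g2]
    simp only [one_mul, smul_eq_mul]
    rw [epstein]
    ring
  · simp only [thetaSeries, exp_thetaForm]
    refine tsum_congr fun p => ?_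
    rw [Complex.real_smul, laplacianCoeff, thetaForm_apply]
    simp only [smul_eq_mul]
    push_cast
    ring

/-- The modulus is independent of the lattice vector, so the twisted sum converges wherever the
Epstein zeta function does. -/
lemma norm_phase (z : ℍ) (p : Lattice) :
    ‖((p.1.1 : ℂ) * (starRingEnd ℂ) (z : ℂ) + p.1.2) ^ 2 / (z.im : ℂ) ^ 2 /
      ((quadForm p (gram z) : ℝ) : ℂ)‖ = 1 / z.im := by
  have hq := quadForm_gram_pos z p
  have hy := z.im_pos
  have hc : (p.1.1 : ℂ) * (starRingEnd ℂ) (z : ℂ) + p.1.2 =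
      (starRingEnd ℂ) ((p.1.1 : ℂ) * z + p.1.2) := by simp
  rw [quadForm_gram] at hq ⊢
  rw [hc, norm_div, norm_div, norm_pow, norm_pow, Complex.norm_real, Complex.norm_real,
    Complex.norm_conj, Real.norm_of_nonneg hq.le, Real.norm_of_nonneg hy.le]
  have : ‖(p.1.1 : ℂ) * z + p.1.2‖ ≠ 0 := fun h => by rw [h] at hq; simp at hq
  field_simp

lemma mellin_thetaSeries_xiCoeff (z : ℍ) {s : ℂ} (hs : 1 < s.re) :
    mellin (thetaSeries (xiCoeff z) z) s = (Real.pi : ℂ) ^ (-s) * Complex.Gamma (s + 1) *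
      ∑' p : Lattice, ((p.1.1 : ℂ) * (starRingEnd ℂ) (z : ℂ) + p.1.2) ^ 2 / (z.im : ℂ) ^ 2 /
        ((quadForm p (gram z) : ℝ) : ℂ) * ((quadForm p (gram z) : ℝ) : ℂ) ^ (-s) := by
  have h1 := hasMellin_pow_mul_exp_neg_pi (s := s) (by linarith) 1
  rw [mellin_tsum_dilate (a := fun p : Lattice =>
      ((p.1.1 : ℂ) * (starRingEnd ℂ) (z : ℂ) + p.1.2) ^ 2 / (z.im : ℂ) ^ 2 /
        ((quadForm p (gram z) : ℝ) : ℂ)) h1.1 (quadForm_gram_pos z)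
    (by simpa only [norm_phase] using (summable_quadForm_rpow z hs).mul_left _) fun t _ => ?_, h1.2,
    Nat.cast_one]
  simp only [thetaSeries, exp_thetaForm]
  refine tsum_congr fun p => ?_
  have hq : ((quadForm p (gram z) : ℝ) : ℂ) ≠ 0 := by exact_mod_cast (quadForm_gram_pos z p).ne'
  have hy : (z.im : ℂ) ≠ 0 := by exact_mod_cast z.im_ne_zero
  rw [Complex.real_smul, xiCoeff, pow_one]
  push_cast
  field_simp

lemma norm_lattice_pos (z : ℍ) (p : Lattice) : 0 < ‖(p.1.1 : ℂ) * z + p.1.2‖ := by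
  have h := quadForm_gram_pos z p
  rw [quadForm_gram] at h
  refine (norm_nonneg _).lt_of_ne fun h0 => ?_
  rw [← h0] at h
  simp at h

lemma quadForm_cpow_neg (z : ℍ) (p : Lattice) (s : ℂ) :
    ((quadForm p (gram z) : ℝ) : ℂ) ^ (-s) =
      (z.im : ℂ) ^ s / ((‖(p.1.1 : ℂ) * z + p.1.2‖ : ℝ) : ℂ) ^ (2 * s) := by
  have hn := norm_lattice_pos z p
  have hy := z.im_pos
  have hq := quadForm_gram_pos z p
  rw [Complex.cpow_def_of_ne_zero (by exact_mod_cast hq.ne'),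
    Complex.cpow_def_of_ne_zero (by exact_mod_cast hy.ne'),
    Complex.cpow_def_of_ne_zero (by exact_mod_cast hn.ne'), ← Complex.ofReal_log hq.le,
    ← Complex.ofReal_log hn.le, ← Complex.ofReal_log hy.le, ← Complex.exp_sub, quadForm_gram,
    Real.log_div (by positivity) hy.ne', Real.log_pow]
  congr 1
  push_cast
  ring

lemma eisensteinSeries_zero (z : ℍ) (s : ℂ) : eisensteinSeries 0 z s = 1 / 2 * epstein z s := by
  rw [eisensteinSeries, epstein]
  congr 1
  refine tsum_congr fun p => ?_
  rw [zpow_zero, one_mul, quadForm_cpow_neg]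

/-- With `w = mz+n` and `Q = w w̄ / y`, one has `w̄²/(y²Q²) = 1/w²`. Weight 2 at `s` thus
corresponds to the twisted Epstein sum at `s + 1`. -/
lemma eisensteinSeries_two (z : ℍ) (s : ℂ) : eisensteinSeries 2 z s =
    1 / 2 * ∑' p : Lattice, ((p.1.1 : ℂ) * (starRingEnd ℂ) (z : ℂ) + p.1.2) ^ 2 / (z.im : ℂ) ^ 2 /
        ((quadForm p (gram z) : ℝ) : ℂ) * ((quadForm p (gram z) : ℝ) : ℂ) ^ (-(s + 1)) := by
  rw [eisensteinSeries]
  congr 1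
  refine tsum_congr fun p => ?_
  have hn := norm_lattice_pos z p
  have hq : ((quadForm p (gram z) : ℝ) : ℂ) ≠ 0 := by exact_mod_cast (quadForm_gram_pos z p).ne'
  have hy : (z.im : ℂ) ≠ 0 := by exact_mod_cast z.im_ne_zero
  have hc : (p.1.1 : ℂ) * (starRingEnd ℂ) (z : ℂ) + p.1.2 =
      (starRingEnd ℂ) ((p.1.1 : ℂ) * z + p.1.2) := by simp
  have hw : (p.1.1 : ℂ) * z + p.1.2 ≠ 0 := norm_pos_iff.1 hn
  have hQ : ((quadForm p (gram z) : ℝ) : ℂ) = ((p.1.1 : ℂ) * z + p.1.2) *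
      (starRingEnd ℂ) ((p.1.1 : ℂ) * z + p.1.2) / z.im := by
    rw [Complex.mul_conj, Complex.normSq_eq_norm_sq, quadForm_gram]
    push_cast
    rfl
  have hexp : ((quadForm p (gram z) : ℝ) : ℂ) ^ (-(s + 1)) =
      ((quadForm p (gram z) : ℝ) : ℂ) ^ (-s) / ((quadForm p (gram z) : ℝ) : ℂ) := by
    rw [neg_add, Complex.cpow_add _ _ hq, Complex.cpow_neg_one, div_eq_mul_inv]
  have hc0 : (starRingEnd ℂ) ((p.1.1 : ℂ) * z + p.1.2) ≠ 0 := by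
    rw [Ne, map_eq_zero]; exact hw
  rw [hexp, quadForm_cpow_neg, hQ, hc, zpow_ofNat]
  generalize ((‖(p.1.1 : ℂ) * z + p.1.2‖ : ℝ) : ℂ) ^ (2 * s) = A
  generalize (starRingEnd ℂ) ((p.1.1 : ℂ) * z + p.1.2) = B at hc0 ⊢
  generalize (p.1.1 : ℂ) * z + p.1.2 = D at hw ⊢
  field_simp

end Completed

/-! ### Taylor coefficients of entire functions -/

section Taylor

lemma entire_eq_of_eq_on_halfPlane {f g : ℂ → ℂ} (hf : Differentiable ℂ f) (hg : Differentiable ℂ g)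
    {c : ℝ} (h : ∀ s : ℂ, c < s.re → f s = g s) : f = g := by
  have ho : IsOpen {s : ℂ | c < s.re} := isOpen_lt continuous_const Complex.continuous_re
  have hmem : {s : ℂ | c < s.re} ∈ nhds ((c + 1 : ℝ) : ℂ) := ho.mem_nhds (by simp)
  exact AnalyticOnNhd.eq_of_eventuallyEq (fun s _ => hf.analyticAt s) (fun s _ => hg.analyticAt s)
    (Filter.mem_of_superset hmem h)

lemma taylorAt_add {f g : ℂ → ℂ} (hf : Differentiable ℂ f) (hg : Differentiable ℂ g) (n : ℕ) :
    taylorAt n (fun s => f s + g s) = taylorAt n f + taylorAt n g := by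
  have := iteratedDeriv_add (n := n) (x := 0) (hf.contDiff (n := n)).contDiffAt
    (hg.contDiff (n := n)).contDiffAt
  rw [taylorAt, taylorAt, taylorAt, ← add_div, ← this]
  rfl

lemma taylorAt_const_mul (f : ℂ → ℂ) (c : ℂ) (n : ℕ) :
    taylorAt n (fun s => c * f s) = c * taylorAt n f := by
  rw [taylorAt, taylorAt, iteratedDeriv_const_mul_field, mul_div_assoc]

lemma taylorAt_comp_neg (f : ℂ → ℂ) (n : ℕ) :
    taylorAt n (fun s => f (-s)) = (-1) ^ n * taylorAt n f := by
  rw [taylorAt, taylorAt, iteratedDeriv_comp_neg, neg_zero, smul_eq_mul, mul_div_assoc]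

lemma iteratedDeriv_id_mul {f : ℂ → ℂ} (hf : Differentiable ℂ f) (n : ℕ) :
    iteratedDeriv (n + 1) (fun s => s * f s) =
      fun s => s * iteratedDeriv (n + 1) f s + (n + 1) * iteratedDeriv n f s := by
  have hd : ∀ m s, HasDerivAt (iteratedDeriv m f) (iteratedDeriv (m + 1) f s) s := fun m s => by
    rw [iteratedDeriv_succ]
    exact ((hf.contDiff (n := ⊤)).differentiable_iteratedDeriv m (by simp) s).hasDerivAt
  induction n with
  | zero =>
    funext s
    rw [zero_add, iteratedDeriv_one]
    refine ((hasDerivAt_id s).mul (hf s).hasDerivAt).deriv.trans ?_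
    simp [iteratedDeriv_one]
    ring
  | succ n ih =>
    funext s
    rw [iteratedDeriv_succ, ih]
    have := ((hasDerivAt_id s).mul (hd (n + 1) s)).add ((hd n s).const_mul ((n : ℂ) + 1))
    refine this.deriv.trans ?_
    push_cast
    simp
    ring

lemma taylorAt_zero_id_mul (f : ℂ → ℂ) : taylorAt 0 (fun s => s * f s) = 0 := by
  simp [taylorAt]

lemma taylorAt_succ_id_mul {f : ℂ → ℂ} (hf : Differentiable ℂ f) (n : ℕ) :
    taylorAt (n + 1) (fun s => s * f s) = taylorAt n f := by
  rw [taylorAt, taylorAt, iteratedDeriv_id_mul hf, Nat.factorial_succ]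
  have h1 : (n ! : ℂ) ≠ 0 := by exact_mod_cast n.factorial_ne_zero
  have h2 : (n : ℂ) + 1 ≠ 0 := by exact_mod_cast n.succ_ne_zero
  push_cast
  field_simp
  ring

lemma taylorAt_quadratic_mul {f : ℂ → ℂ} (hf : Differentiable ℂ f) (c d : ℂ) (n : ℕ) :
    taylorAt n (fun s => c * (s * (s * f s) + d * (s * f s))) =
      c * (taylorAt n (fun s => s * (s * f s)) + d * taylorAt n (fun s => s * f s)) := by
  have h1 : Differentiable ℂ fun s => s * f s := differentiable_id.mul hf
  have h2 : Differentiable ℂ fun s => s * (s * f s) := differentiable_id.mul h1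
  rw [taylorAt_const_mul, taylorAt_add h2 (h1.const_mul d), taylorAt_const_mul]

end Taylor

/-! ### The continued Eisenstein series and the operators on their coefficients -/

section Completed

/-- The entire continuation of the doubly completed weight `0` Eisenstein series. -/
noncomputable def completedZero (z : ℍ) (s : ℂ) : ℂ :=
  1 / 2 + 1 / 2 * (s * (s * symMellin (thetaSeries (fun _ => 1) z) s) +
    -1 * (s * symMellin (thetaSeries (fun _ => 1) z) s))

/-- The entire continuation of the doubly completed weight `2` Eisenstein series. -/
noncomputable def completedTwo (z : ℍ) (s : ℂ) : ℂ :=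
  1 / 2 * (s * (s * symMellin (thetaSeries (xiCoeff z) z) (-s)) +
    1 * (s * symMellin (thetaSeries (xiCoeff z) z) (-s)))

lemma differentiable_symMellin_one (z : ℍ) :
    Differentiable ℂ (symMellin (thetaSeries (fun _ => 1) z)) :=
  ((isSubexponential_const 1).decaysExponentially z).differentiable_symMellin

lemma differentiable_symMellin_xi_neg (z : ℍ) :
    Differentiable ℂ fun s => symMellin (thetaSeries (xiCoeff z) z) (-s) :=
  ((isSubexponential_xiCoeff z).decaysExponentially z).differentiable_symMellin.comp
    differentiable_neg

lemma differentiable_completedZero (z : ℍ) : Differentiable ℂ (completedZero z) := by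
  have := differentiable_symMellin_one z
  unfold completedZero
  fun_prop

lemma differentiable_completedTwo (z : ℍ) : Differentiable ℂ (completedTwo z) := by
  have := differentiable_symMellin_xi_neg z
  unfold completedTwo
  fun_prop

/-- The summand `1/2` of `completedZero` is half the pole term `1/(s(s-1))` after multiplication by
`s(s-1)`. -/
lemma completedZero_eq (z : ℍ) {s : ℂ} (hs : 1 < s.re) : completedZero z s =
    s * (s - 1) * ((Real.pi : ℂ) ^ (-s) * Complex.Gamma s * (1 / 2 * epstein z s)) := by
  have hs0 : s ≠ 0 := fun h => by rw [h] at hs; norm_num at hs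
  have hs1 : s - 1 ≠ 0 := fun h => by rw [sub_eq_zero.1 h] at hs; norm_num at hs
  have h := ((isSubexponential_const 1).decaysExponentially z).hasMellin (g₀ := 1)
    (fun t ht => by rw [add_comm, thetaSeries_one_inv z ht, add_comm 1]) hs
  rw [mellin_thetaSeries_one z hs] at h
  have h2 : symMellin (thetaSeries (fun _ => 1) z) s =
      (Real.pi : ℂ) ^ (-s) * Complex.Gamma s * epstein z s - 1 / (s * (s - 1)) := by
    rw [h]; ring
  rw [completedZero, h2]
  field_simp
  ring

/-- The Mellin transform is taken at `s + 1`, and the symmetry `s ↦ 1 - s` carries `s + 1` to the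
argument `-s` of `completedTwo`. There is no pole, as the functional equation has no constant. -/
lemma completedTwo_eq (z : ℍ) {s : ℂ} (hs : 0 < s.re) : completedTwo z s =
    (s + 1) * s * ((Real.pi : ℂ) ^ (-(s + 1)) * Complex.Gamma (s + 2) *
      eisensteinSeries 2 z s) := by
  have h := ((isSubexponential_xiCoeff z).decaysExponentially z).hasMellin (g₀ := 0)
    (fun t ht => by rw [add_zero, add_zero, thetaSeries_xiCoeff_inv z ht])
    (s := s + 1) (by simpa using hs)
  rw [mellin_thetaSeries_xiCoeff z (by simpa using hs), zero_div, add_zero,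
    ← symMellin_one_sub, show (1 : ℂ) - (s + 1) = -s by ring,
    show s + 1 + 1 = s + 2 by ring] at h
  rw [completedTwo, ← h, eisensteinSeries_two]
  ring

lemma isDoublyCompleted_zero (z : ℍ) : IsDoublyCompleted 0 z (completedZero z) := by
  refine ⟨differentiable_completedZero z, fun s hs => ?_⟩
  rw [completedZero_eq z (by simpa using hs), eisensteinSeries_zero]
  simp

lemma isDoublyCompleted_two (z : ℍ) : IsDoublyCompleted 2 z (completedTwo z) := by
  refine ⟨differentiable_completedTwo z, fun s hs => ?_⟩
  rw [completedTwo_eq z (by simpa using hs)]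
  have h2 : s + 1 + 1 = s + 2 := by ring
  simp [h2]

/-- Uniqueness of continuation pins down the function chosen by `Classical.epsilon`. -/
lemma IsDoublyCompleted.doublyCompleted_eq {k : ℤ} {z : ℍ} {f : ℂ → ℂ}
    (hf : IsDoublyCompleted k z f) : doublyCompleted k z = f := by
  have h : IsDoublyCompleted k z (doublyCompleted k z) := Classical.epsilon_spec ⟨f, hf⟩
  exact entire_eq_of_eq_on_halfPlane h.1 hf.1 fun s hs => (h.2 s hs).trans (hf.2 s hs).symm

/-- `Δ₀` multiplies the completed Eisenstein series by `s (s - 1)`. -/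
lemma symMellin_laplacianCoeff (z : ℍ) :
    symMellin (thetaSeries (laplacianCoeff z) z) = fun s => 2 * completedZero z s := by
  have hd := (isSubexponential_laplacianCoeff z).decaysExponentially z
  refine entire_eq_of_eq_on_halfPlane (c := 1) hd.differentiable_symMellin
    ((differentiable_completedZero z).const_mul 2) fun s hs => ?_
  have h := hd.hasMellin (g₀ := 0)
    (fun t ht => by rw [add_zero, add_zero, thetaSeries_laplacianCoeff_inv z ht]) hs
  rw [mellin_thetaSeries_laplacianCoeff z hs, zero_div, add_zero] at h
  rw [← h, completedZero_eq z hs]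
  ring

lemma F_eq (n : ℕ) (z : ℍ) : F n z = taylorAt n (completedZero z) := by
  rw [F, taylorCoeff, (isDoublyCompleted_zero z).doublyCompleted_eq, taylorAt]

lemma G_eq (n : ℕ) (z : ℍ) : G n z = taylorAt n (completedTwo z) := by
  rw [G, taylorCoeff, (isDoublyCompleted_two z).doublyCompleted_eq, taylorAt]

lemma mellinCoeff_laplacianCoeff (n : ℕ) (z : ℍ) :
    mellinCoeff (laplacianCoeff z) n z = 2 * F n z := by
  rw [mellinCoeff, symMellin_laplacianCoeff, taylorAt_const_mul, F_eq]

lemma taylorAt_completedZero (n : ℕ) (z : ℍ) : taylorAt n (completedZero z) =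
    taylorAt n (fun _ => 1 / 2) + 1 / 2 *
      (taylorAt n (fun s => s * (s * symMellin (thetaSeries (fun _ => 1) z) s)) +
        -1 * taylorAt n (fun s => s * symMellin (thetaSeries (fun _ => 1) z) s)) := by
  have h := differentiable_symMellin_one z
  rw [← taylorAt_quadratic_mul h]
  exact taylorAt_add (differentiable_const _) (by fun_prop) n

lemma taylorAt_succ_const (n : ℕ) (c : ℂ) : taylorAt (n + 1) (fun _ => c) = 0 := by
  simp [taylorAt, iteratedDeriv_const]

lemma F_zero : F 0 = fun _ => 1 / 2 := by
  funext z
  rw [F_eq]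
  simp [taylorAt, completedZero]

lemma F_one : F 1 = fun z => ((-(1 / 2) : ℝ) : ℂ) * mellinCoeff (fun _ => 1) 0 z + 0 := by
  funext z
  have h := differentiable_symMellin_one z
  rw [F_eq, taylorAt_completedZero, taylorAt_succ_const, taylorAt_succ_id_mul (by fun_prop),
    taylorAt_succ_id_mul h, taylorAt_zero_id_mul, mellinCoeff]
  push_cast
  ring

/-- The factors `s²` and `-s` shift indices by 2 and 1; indices 0 and 1 are separate because shifted
indices fall below 0 there. -/
lemma F_add_two (n : ℕ) : F (n + 2) = fun z => ((1 / 2 : ℝ) : ℂ) * mellinCoeff (fun _ => 1) n z +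
    ((-(1 / 2) : ℝ) : ℂ) * mellinCoeff (fun _ => 1) (n + 1) z := by
  funext z
  have h := differentiable_symMellin_one z
  rw [F_eq, taylorAt_completedZero, taylorAt_succ_const, taylorAt_succ_id_mul (by fun_prop),
    taylorAt_succ_id_mul h, taylorAt_succ_id_mul h, mellinCoeff, mellinCoeff]
  push_cast
  ring

lemma G_zero (z : ℍ) : G 0 z = 0 := by
  rw [G_eq]
  simp [taylorAt, completedTwo]

lemma G_one (z : ℍ) : G 1 z = 1 / 2 * mellinCoeff (xiCoeff z) 0 z := by
  have h := differentiable_symMellin_xi_neg z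
  have h1 := taylorAt_quadratic_mul h (1 / 2) 1 1
  rw [G_eq, mellinCoeff]
  refine h1.trans ?_
  rw [taylorAt_succ_id_mul (by fun_prop), taylorAt_succ_id_mul h, taylorAt_zero_id_mul,
    taylorAt_comp_neg (symMellin (thetaSeries (xiCoeff z) z))]
  ring

lemma G_add_two (n : ℕ) (z : ℍ) : G (n + 2) z = (-1) ^ n * (1 / 2 * mellinCoeff (xiCoeff z) n z -
    1 / 2 * mellinCoeff (xiCoeff z) (n + 1) z) := by
  have h := differentiable_symMellin_xi_neg z
  have h1 := taylorAt_quadratic_mul h (1 / 2) 1 (n + 2)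
  rw [G_eq, mellinCoeff, mellinCoeff]
  refine h1.trans ?_
  rw [taylorAt_succ_id_mul (by fun_prop), taylorAt_succ_id_mul h, taylorAt_succ_id_mul h,
    taylorAt_comp_neg (symMellin (thetaSeries (xiCoeff z) z)),
    taylorAt_comp_neg (symMellin (thetaSeries (xiCoeff z) z))]
  ring

lemma xi_add_mul {f g : ℍ → ℂ} (hf : IsSmooth f) (hg : IsSmooth g) (a b : ℝ) (k : ℤ) (z : ℍ) :
    xi k (fun z => a * f z + b * g z) z = a * xi k f z + b * xi k g z := by
  have h := xi_sum (s := Finset.univ) (f := ![f, g])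
    (by simp [Fin.forall_fin_two, hf, hg]) ![a, b] k z
  simpa [Fin.sum_univ_two] using h

lemma laplacian_add_mul {f g : ℍ → ℂ} (hf : IsSmooth f) (hg : IsSmooth g) (a b : ℂ) (k : ℤ)
    (z : ℍ) :
    laplacian k (fun z => a * f z + b * g z) z = a * laplacian k f z + b * laplacian k g z := by
  have h := laplacian_sum (s := Finset.univ) (f := ![f, g])
    (by simp [Fin.forall_fin_two, hf, hg]) ![a, b] k z
  simpa [Fin.sum_univ_two] using h

lemma isSmooth_F : ∀ n : ℕ, IsSmooth (F n)
  | 0 => by rw [F_zero]; exact isSmooth_const _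
  | 1 => by
    rw [F_one]
    exact ((isSmooth_mellinCoeff 0).const_mul _).add (isSmooth_const 0)
  | n + 2 => by
    rw [F_add_two]
    exact ((isSmooth_mellinCoeff n).const_mul _).add ((isSmooth_mellinCoeff (n + 1)).const_mul _)

/-- Applied to coefficients, `ξ₀` turns `s(s-1)S(s)/2` into the same expression for `xiCoeff`, which
is `completedTwo z (-s)`; hence the sign. -/
lemma xi_F : ∀ (n : ℕ) (z : ℍ), xi 0 (F n) z = (-1) ^ n * G n z
  | 0, z => by
    rw [F_zero, G_zero]
    simp [xi, dbar_eq, dirDeriv_const]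
  | 1, z => by
    rw [F_one, G_one, xi_affine (isSmooth_mellinCoeff 0), xi_mellinCoeff]
    push_cast
    ring
  | n + 2, z => by
    rw [F_add_two, G_add_two, xi_add_mul (isSmooth_mellinCoeff n) (isSmooth_mellinCoeff (n + 1)),
      xi_mellinCoeff, xi_mellinCoeff, ← mul_assoc, ← pow_add, Even.neg_one_pow ⟨n + 1, by ring⟩]
    push_cast
    ring

lemma laplacian_F_zero (z : ℍ) : laplacian 0 (F 0) z = 0 := by
  have h : ∀ v : ℂ, dirDeriv v (F 0) = fun _ => 0 := fun v => by
    rw [F_zero]; exact funext fun z => dirDeriv_const v _ z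
  simp [laplacian_eq, h, dirDeriv_const]

lemma laplacian_F_one (z : ℍ) : laplacian 0 (F 1) z = -F 0 z := by
  rw [F_one, laplacian_affine (isSmooth_mellinCoeff 0), laplacian_mellinCoeff,
    mellinCoeff_laplacianCoeff]
  push_cast
  ring

/-- By `symMellin_laplacianCoeff`, `Δ₀` replaces `S(s)` by twice the completed series, so this is
the coefficient of `s^{n+2}` in `s(s-1)` times that series. -/
lemma laplacian_F_add_two (n : ℕ) (z : ℍ) :
    laplacian 0 (F (n + 2)) z = F n z - F (n + 1) z := by
  rw [F_add_two, laplacian_add_mul (isSmooth_mellinCoeff n) (isSmooth_mellinCoeff (n + 1)),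
    laplacian_mellinCoeff, laplacian_mellinCoeff, mellinCoeff_laplacianCoeff,
    mellinCoeff_laplacianCoeff]
  push_cast
  ring

end Completed

/-! ### Symmetrized coefficients and the ladder identities -/

section Symmetrized

lemma add_sum_Icc_one (n : ℕ) (f : ℕ → ℂ) :
    f 0 + ∑ l ∈ Finset.Icc 1 n, f l = ∑ l ∈ Finset.range (n + 1), f l := by
  rw [Finset.sum_range_succ', add_comm]
  congr 1
  rw [← Finset.Ico_add_one_right_eq_Icc, Finset.sum_Ico_eq_sum_range]
  simp [add_comm]

/-- The separate leading term is the case `l = 0`. Casting the coefficients from `ℝ` makes the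
conjugate-linear `ξ₀` pass through the sum. -/
lemma symF_eq (n : ℕ) : symF n = fun z => ∑ l ∈ Finset.range (n + 1),
    (((-1) ^ n * ((n + l).choose n : ℝ) : ℝ) : ℂ) * F (n - l) z := by
  funext z
  have h := add_sum_Icc_one n fun l => ((n + l).choose n : ℂ) * F (n - l) z
  simp only [add_zero, Nat.choose_self, Nat.cast_one, one_mul, Nat.sub_zero] at h
  rw [symF, h, Finset.mul_sum]
  refine Finset.sum_congr rfl fun l _ => ?_
  push_cast
  ring

lemma symG_eq (n : ℕ) (z : ℍ) : symG n z = ∑ l ∈ Finset.range (n + 1),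
    (-1) ^ l * ((n + l).choose n : ℂ) * G (n - l) z := by
  have h := add_sum_Icc_one n fun l => (-1) ^ l * ((n + l).choose n : ℂ) * G (n - l) z
  simp only [add_zero, Nat.choose_self, Nat.cast_one, one_mul, Nat.sub_zero, pow_zero] at h
  rw [symG, h]

lemma isSmooth_symF (n : ℕ) : IsSmooth (symF n) := by
  rw [symF_eq]
  exact IsSmooth.sum fun l _ => (isSmooth_F _).const_mul _

lemma xi_symF (n : ℕ) (z : ℍ) : xi 0 (symF n) z = symG n z := by
  rw [symF_eq, symG_eq, xi_sum fun l _ => isSmooth_F _]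
  refine Finset.sum_congr rfl fun l hl => ?_
  obtain ⟨m, rfl⟩ := Nat.exists_eq_add_of_le (Nat.lt_succ_iff.1 (Finset.mem_range.1 hl))
  rw [xi_F, Nat.add_sub_cancel_left]
  have h : ((-1 : ℂ) ^ m) * (-1) ^ m = 1 := by rw [← mul_pow]; simp
  push_cast
  rw [pow_add]
  linear_combination (-1) ^ l * ((l + m + l).choose (l + m) : ℂ) * G m z * h

/-- The Pascal rule summed against a sequence and its twisted second difference. -/
lemma sum_choose_mul_of_recurrence {f h : ℕ → ℂ} (h0 : h 0 = 0) (h1 : h 1 = -f 0)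
    (h2 : ∀ m, h (m + 2) = f m - f (m + 1)) (n : ℕ) :
    ∑ l ∈ Finset.range (n + 2), ((n + 1 + l).choose (n + 1) : ℂ) * h (n + 1 - l) =
      -∑ l ∈ Finset.range (n + 1), ((n + l).choose n : ℂ) * f (n - l) := by
  have hstep : ∀ l ∈ Finset.range n, h (n + 1 - l) = f (n - (l + 1)) - f (n - l) := by
    intro l hl
    obtain ⟨m, rfl⟩ := Nat.exists_eq_add_of_lt (Finset.mem_range.1 hl)
    rw [show l + m + 1 + 1 - l = m + 2 by omega, h2, show l + m + 1 - (l + 1) = m by omega,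
      show l + m + 1 - l = m + 1 by omega]
  have e1 : ∑ l ∈ Finset.range (n + 2), ((n + 1 + l).choose (n + 1) : ℂ) * h (n + 1 - l) =
      ∑ l ∈ Finset.range n, ((n + 1 + l).choose (n + 1) : ℂ) * f (n - (l + 1)) -
      ∑ l ∈ Finset.range (n + 1), ((n + 1 + l).choose (n + 1) : ℂ) * f (n - l) := by
    -- The terms `l = n + 1` and `l = n` involve `h 0` and `h 1`, which the recurrence does not
    -- cover.
    rw [Finset.sum_range_succ, Finset.sum_range_succ, Finset.sum_range_succ _ n,
      show n + 1 - n = 1 by omega, h1, Nat.sub_self, h0, Nat.sub_self,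
      Finset.sum_congr rfl fun l hl => by rw [hstep l hl]]
    simp only [mul_sub, Finset.sum_sub_distrib]
    ring
  -- An index shift; the term `l = 0` drops because `n.choose (n + 1) = 0`. It prepares Pascal's
  -- rule `C(n+1+l,n+1) = C(n+l,n) + C(n+l,n+1)`.
  have e2 : ∑ l ∈ Finset.range (n + 1), ((n + l).choose (n + 1) : ℂ) * f (n - l) =
      ∑ l ∈ Finset.range n, ((n + 1 + l).choose (n + 1) : ℂ) * f (n - (l + 1)) := by
    rw [Finset.sum_range_succ']
    simp [add_comm, add_left_comm]
  rw [e1, ← e2, ← Finset.sum_sub_distrib, ← Finset.sum_neg_distrib]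
  refine Finset.sum_congr rfl fun l _ => ?_
  rw [show n + 1 + l = n + l + 1 by ring, Nat.choose_succ_succ]
  push_cast
  ring

lemma laplacian_symF_succ (n : ℕ) (z : ℍ) : laplacian 0 (symF (n + 1)) z = symF n z := by
  rw [symF_eq, laplacian_sum fun l _ => isSmooth_F _]
  have h := sum_choose_mul_of_recurrence (f := fun m => F m z) (h := fun m => laplacian 0 (F m) z)
    (laplacian_F_zero z) (laplacian_F_one z) (fun m => laplacian_F_add_two m z) n
  have e1 : ∑ l ∈ Finset.range (n + 2),
      (((-1) ^ (n + 1) * ((n + 1 + l).choose (n + 1) : ℝ) : ℝ) : ℂ) *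
      laplacian 0 (F (n + 1 - l)) z = (-1) ^ (n + 1) *
      ∑ l ∈ Finset.range (n + 2), ((n + 1 + l).choose (n + 1) : ℂ) *
        laplacian 0 (F (n + 1 - l)) z := by
    rw [Finset.mul_sum]
    refine Finset.sum_congr rfl fun l _ => ?_
    push_cast
    ring
  rw [e1, h, symF_eq, pow_succ, ← Finset.sum_neg_distrib, Finset.mul_sum]
  refine Finset.sum_congr rfl fun l _ => ?_
  push_cast
  ring

lemma laplacian_symF_zero (z : ℍ) : laplacian 0 (symF 0) z = 0 := by
  have : symF 0 = F 0 := by funext z; simp [symF]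
  rw [this, laplacian_F_zero]

/-- From here weight 2 is formal: smoothness and all identities pass from `symF` through the
factorizations of `Δ₀` and `Δ₂`. -/
lemma symG_eq_xi (n : ℕ) : symG n = xi 0 (symF n) := funext fun z => (xi_symF n z).symm

lemma isSmooth_symG (n : ℕ) : IsSmooth (symG n) := by
  rw [symG_eq_xi]; exact isSmooth_xi_zero (isSmooth_symF n)

lemma xi_symG_succ (n : ℕ) (z : ℍ) : xi 2 (symG (n + 1)) z = symF n z := by
  rw [symG_eq_xi, xi_two_xi_zero (isSmooth_symF _), laplacian_symF_succ]

lemma xi_symG_zero (z : ℍ) : xi 2 (symG 0) z = 0 := by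
  rw [symG_eq_xi, xi_two_xi_zero (isSmooth_symF _), laplacian_symF_zero]

lemma laplacian_symG_succ (n : ℕ) (z : ℍ) : laplacian 2 (symG (n + 1)) z = symG n z := by
  rw [← xi_zero_xi_two (isSmooth_symG _), funext (xi_symG_succ n), xi_symF]

lemma laplacian_symG_zero (z : ℍ) : laplacian 2 (symG 0) z = 0 := by
  rw [← xi_zero_xi_two (isSmooth_symG _), funext xi_symG_zero]
  simp [xi, dbar_eq, dirDeriv_const]

end Symmetrized

end PolyharmonicMaass

theorem theorem1p3 :
    -- the doubly completed Eisenstein series exist as entire functions of `s`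
    (∀ z : UpperHalfPlane,
      PolyharmonicMaass.IsDoublyCompleted 0 z (PolyharmonicMaass.doublyCompleted 0 z) ∧
      PolyharmonicMaass.IsDoublyCompleted 2 z (PolyharmonicMaass.doublyCompleted 2 z)) ∧
    -- the differential operators are applied to smooth functions
    (∀ n : ℕ, PolyharmonicMaass.IsSmooth (PolyharmonicMaass.symF n) ∧
      PolyharmonicMaass.IsSmooth (PolyharmonicMaass.symG n)) ∧
    -- weight `0`
    (∀ (n : ℕ) (z : UpperHalfPlane),
      PolyharmonicMaass.laplacian 0 (PolyharmonicMaass.symF (n + 1)) z =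
        PolyharmonicMaass.symF n z) ∧
    (∀ (n : ℕ) (z : UpperHalfPlane),
      PolyharmonicMaass.xi 0 (PolyharmonicMaass.symF n) z = PolyharmonicMaass.symG n z) ∧
    -- weight `2`
    (∀ (n : ℕ) (z : UpperHalfPlane),
      PolyharmonicMaass.laplacian 2 (PolyharmonicMaass.symG (n + 1)) z =
        PolyharmonicMaass.symG n z) ∧
    (∀ (n : ℕ) (z : UpperHalfPlane),
      PolyharmonicMaass.xi 2 (PolyharmonicMaass.symG (n + 1)) z =
        PolyharmonicMaass.symF n z) ∧
    -- the case `n = 0`, where the functions of index `-1` are zero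
    (∀ z : UpperHalfPlane,
      PolyharmonicMaass.laplacian 0 (PolyharmonicMaass.symF 0) z = 0 ∧
      PolyharmonicMaass.laplacian 2 (PolyharmonicMaass.symG 0) z = 0 ∧
      PolyharmonicMaass.xi 2 (PolyharmonicMaass.symG 0) z = 0) := by

  open PolyharmonicMaass in
  exact ⟨fun z => ⟨by
        rw [(isDoublyCompleted_zero z).doublyCompleted_eq]; exact isDoublyCompleted_zero z,
      by rw [(isDoublyCompleted_two z).doublyCompleted_eq]; exact isDoublyCompleted_two z⟩,
    fun n => ⟨isSmooth_symF n, isSmooth_symG n⟩, laplacian_symF_succ, xi_symF, laplacian_symG_succ,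
    xi_symG_succ, fun z => ⟨laplacian_symF_zero z, laplacian_symG_zero z, xi_symG_zero z⟩⟩
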